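/- Let $\Sigma$ be a smooth surface, minimally immersed in $\mathbb{R}^3$ (that is, a smooth immersion with vanishing mean curvature), with a smooth unit normal vector field $\mathbf{N}$, induced metric $\mathbf{g}_\Sigma$ and Gauss curvature $\mathcal{K}$ of $\mathbf{g}_\Sigma$. Let $\mathbf{V}\in\mathbb{R}^3$ be a fixed unit vector and let $\mathbf{N}_{\mathbf{V}}(p)=\langle \mathbf{N}(p),\mathbf{V}\rangle$ be the angle function. Assume that $\mathcal{K}<0$ and $\mathbf{N}_{\mathbf{V}}>-1$ everywhere on $\Sigma$. Then the conformally changed Riemannian metrics $$\mathcal{G}_{\mathrm{Ricci}}=(-\mathcal{K})^{1/2}\,\mathbf{g}_\Sigma,\qquad \mathcal{G}_{\mathrm{Chern}}=(1+\mathbf{N}_{\mathbf{V}})^2\,\mathbf{g}_\Sigma=\frac{(1+\mathbf{N}_{\mathbf{V}})^2}{(-\mathcal{K})^{1/2}}\,\mathcal{G}_{\mathrm{Ricci}}$$ are flat (their Gauss curvatures vanish identically), and the Chern–Ricci function $$\ln\left(\frac{(1+\mathbf{N}_{\mathbf{V}})^2}{(-\mathcal{K})^{1/2}}\right)$$ is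 harmonic on $\Sigma$ with respect to each of the three metrics $\mathbf{g}_\Sigma$, $\mathcal{G}_{\mathrm{Ricci}}$ and $\mathcal{G}_{\mathrm{Chern}}$ (it is of class $C^2$ and is annihilated by the Laplace–Beltrami operator of each metric). -/

import Mathlib

open scoped Manifold ContDiff RealInnerProductSpace

noncomputable section

namespace ChernRicci

/-! ### Calculus in coordinates on the plane -/

/-- The model plane `ℝ²`. -/
abbrev E2 := EuclideanSpace ℝ (Fin 2)

/-- Euclidean space `ℝ³`. -/
abbrev E3 := EuclideanSpace ℝ (Fin 3)

/-- The `i`-th coordinate vector of `ℝ²`. -/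
def coordVec (i : Fin 2) : E2 := EuclideanSpace.single i (1 : ℝ)

/-- The partial derivative `∂ᵢ f` at `x`. -/
def pderiv (i : Fin 2) (f : E2 → ℝ) (x : E2) : ℝ := fderiv ℝ f x (coordVec i)

/-- Christoffel symbols
`Γᵏᵢⱼ = ½ ∑ₗ gᵏˡ (∂ᵢ gⱼₗ + ∂ⱼ gᵢₗ - ∂ₗ gᵢⱼ)` of a metric with coefficient matrix `G`. -/
def christoffel (G : E2 → Matrix (Fin 2) (Fin 2) ℝ) (k i j : Fin 2) (x : E2) : ℝ :=
  (1 / 2) * ∑ l, (G x)⁻¹ k l *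
    (pderiv i (fun y => G y j l) x + pderiv j (fun y => G y i l) x
      - pderiv l (fun y => G y i j) x)

/-- The coefficients `Rˡᵢⱼₖ` of the curvature tensor of the Levi-Civita connection,
`R(∂ᵢ, ∂ⱼ)∂ₖ = ∇ᵢ∇ⱼ∂ₖ - ∇ⱼ∇ᵢ∂ₖ = ∑ₗ Rˡᵢⱼₖ ∂ₗ`. -/
def curvatureCoeff (G : E2 → Matrix (Fin 2) (Fin 2) ℝ) (l i j k : Fin 2) (x : E2) : ℝ :=
  pderiv i (christoffel G l j k) x - pderiv j (christoffel G l i k) x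
    + ∑ m, (christoffel G l i m x * christoffel G m j k x
      - christoffel G l j m x * christoffel G m i k x)

/-- Gauss curvature in coordinates, `K = g(R(∂₁, ∂₂)∂₂, ∂₁) / (g₁₁ g₂₂ - g₁₂²)`. -/
def coordGaussCurvature (G : E2 → Matrix (Fin 2) (Fin 2) ℝ) (x : E2) : ℝ :=
  (∑ l, G x l 0 * curvatureCoeff G l 0 1 1 x) / (G x).det

/-- The Laplace–Beltrami operator in coordinates,
`Δ f = (det g)^(-1/2) ∑ᵢⱼ ∂ᵢ ((det g)^(1/2) gⁱʲ ∂ⱼ f)`. -/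
def coordLaplacian (G : E2 → Matrix (Fin 2) (Fin 2) ℝ) (f : E2 → ℝ) (x : E2) : ℝ :=
  (1 / √(G x).det) *
    ∑ i, pderiv i (fun y => √(G y).det * ∑ j, (G y)⁻¹ i j * pderiv j f y) x

/-! ### Metrics on a smooth surface -/

section Surface

variable {S : Type*} [TopologicalSpace S] [ChartedSpace E2 S]

/-- Fields of bilinear forms on the tangent planes of the surface `S`. -/
abbrev BilinField (S : Type*) [TopologicalSpace S] [ChartedSpace E2 S] :=
  ∀ p : S, LinearMap.BilinForm ℝ (TangentSpace (𝓡 2) p)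

/-- The coordinate vector field `∂ᵢ` of the chart around `p₀`, at the point with coordinates
`x`. -/
def chartFrame (p₀ : S) (i : Fin 2) (x : E2) :
    TangentSpace (𝓡 2) ((extChartAt (𝓡 2) p₀).symm x) :=
  mfderiv (𝓡 2) (𝓡 2) (extChartAt (𝓡 2) p₀).symm x (coordVec i)

/-- The coefficient matrix `gᵢⱼ = g(∂ᵢ, ∂ⱼ)` in the chart around `p₀`, as a function of the
coordinates. -/
def chartMatrix (g : BilinField S) (p₀ : S) (x : E2) : Matrix (Fin 2) (Fin 2) ℝ :=
  Matrix.of fun i j => g ((extChartAt (𝓡 2) p₀).symm x) (chartFrame p₀ i x) (chartFrame p₀ j x)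

/-- `g` is a smooth Riemannian metric. -/
structure IsRiemannianMetric (g : BilinField S) : Prop where
  symm : ∀ (p : S) (v w : TangentSpace (𝓡 2) p), g p v w = g p w v
  pos : ∀ (p : S) (v : TangentSpace (𝓡 2) p), v ≠ 0 → 0 < g p v v
  smooth : ∀ (p₀ : S) (i j : Fin 2),
    ContDiffOn ℝ ∞ (fun x => chartMatrix g p₀ x i j) (extChartAt (𝓡 2) p₀).target

/-- The Gauss curvature `𝒦_g` at `p`, computed in the chart around `p`. -/
def gaussCurvature (g : BilinField S) (p : S) : ℝ :=
  coordGaussCurvature (chartMatrix g p) (extChartAt (𝓡 2) p p)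

/-- The Laplacian `Δ_g f` at `p`, computed in the chart around `p`. -/
def laplacian (g : BilinField S) (f : S → ℝ) (p : S) : ℝ :=
  coordLaplacian (chartMatrix g p) (f ∘ (extChartAt (𝓡 2) p).symm) (extChartAt (𝓡 2) p p)

/-- `f` is harmonic with respect to `g`: it is of class `C²` and `Δ_g f = 0`. -/
def IsHarmonic (g : BilinField S) (f : S → ℝ) : Prop :=
  ContMDiff (𝓡 2) 𝓘(ℝ, ℝ) 2 f ∧ ∀ p, laplacian g f p = 0

/-- `g` is a flat Riemannian metric: its Gauss curvature vanishes. -/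
def IsFlatMetric (g : BilinField S) : Prop :=
  IsRiemannianMetric g ∧ ∀ p, gaussCurvature g p = 0

/-- The conformally changed field `lam · g`. -/
def conformalChange (lam : S → ℝ) (g : BilinField S) : BilinField S := fun p => lam p • g p

/-! ### Immersed surfaces in `ℝ³` -/

/-- The differential at `p` of a map from the surface to `ℝ³`. -/
def differential (X : S → E3) (p : S) : TangentSpace (𝓡 2) p →L[ℝ] E3 :=
  mfderiv (𝓡 2) (𝓡 3) X p

/-- The metric induced by `X`: `g(v, w) = ⟨dX v, dX w⟩`. -/
def inducedMetric (X : S → E3) : BilinField S := fun p =>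
  (innerₗ E3).compl₁₂ (differential X p).toLinearMap (differential X p).toLinearMap

/-- Matrix of the first fundamental form in the standard basis of the tangent plane. -/
def firstForm (X : S → E3) (p : S) : Matrix (Fin 2) (Fin 2) ℝ :=
  Matrix.of fun i j => ⟪differential X p (coordVec i), differential X p (coordVec j)⟫

/-- Matrix of the second fundamental form `II(v, w) = -⟨dN v, dX w⟩` in the same basis. -/
def secondForm (X N : S → E3) (p : S) : Matrix (Fin 2) (Fin 2) ℝ :=
  Matrix.of fun i j => -⟪differential N p (coordVec i), differential X p (coordVec j)⟫

/-- The mean curvature, half the trace of the shape operator `I⁻¹ II`. -/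
def meanCurvature (X N : S → E3) (p : S) : ℝ :=
  (1 / 2) * ((firstForm X p)⁻¹ * secondForm X N p).trace

/-- `X` is a smooth immersion of the surface `S` in `ℝ³` with smooth unit normal field `N`, and
it is minimal: its mean curvature vanishes. -/
structure IsMinimalSurface (X N : S → E3) : Prop where
  smooth : ContMDiff (𝓡 2) (𝓡 3) ∞ X
  immersion : ∀ p, Function.Injective (differential X p)
  normal_smooth : ContMDiff (𝓡 2) (𝓡 3) ∞ N
  normal_unit : ∀ p, ‖N p‖ = 1
  normal_orth : ∀ p v, ⟪N p, differential X p v⟫ = 0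
  minimal : ∀ p, meanCurvature X N p = 0

/-- The Gauss curvature `𝒦` of the induced metric. -/
def surfaceCurvature (X : S → E3) (p : S) : ℝ := gaussCurvature (inducedMetric X) p

/-- The angle function `N_V = ⟨N, V⟩`. -/
def angle (N : S → E3) (V : E3) (p : S) : ℝ := ⟪N p, V⟫

/-- The metric `(-𝒦)^(1/2) g`. -/
def ricciMetric (X : S → E3) : BilinField S :=
  conformalChange (fun p => √(-surfaceCurvature X p)) (inducedMetric X)

/-- The metric `(1 + N_V)² g`. -/
def chernMetric (X N : S → E3) (V : E3) : BilinField S :=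
  conformalChange (fun p => (1 + angle N V p) ^ 2) (inducedMetric X)

/-- The conformal factor `(1 + N_V)² / (-𝒦)^(1/2)`. -/
def starFactor (X N : S → E3) (V : E3) (p : S) : ℝ :=
  (1 + angle N V p) ^ 2 / √(-surfaceCurvature X p)

/-- The Chern–Ricci function `ln ((1 + N_V)² / (-𝒦)^(1/2))`. -/
def chernRicciFunction (X N : S → E3) (V : E3) (p : S) : ℝ :=
  Real.log (starFactor X N V p)

end Surface

end ChernRicci

end

open ChernRicci

/-! Write `k = -K`, `t = 1 + ⟨N, V⟩`, and `Δ` for the Laplacian of the induced metric `g`. For a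
minimal surface the Cayley–Hamilton identity for the shape operator reads `III = -K I`
(`thirdForm_of_minimal`), so `k g` is the pullback of the round metric by the Gauss map `N` and has
curvature `1` (`coordGaussCurvature_sphere`). Stereographic projection from `-V` scales the round
metric by `t⁻²` (`inner_vderiv_stereo`). Composed with `N` it is an immersion into a plane inducing
`(k / t²) g`, which is therefore flat (`coordGaussCurvature_plane`).

In dimension two `lam · K(lam g) = K(g) - ½ Δ log lam` (`coordGaussCurvature_conformal`). Applied to
the factors `k` and `k / t²` it gives `Δ log k = -4k` and `Δ log t = -k`. Applied to `√k` and `t²`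
it then gives curvature zero, and `Δ (2 log t - ½ log k) = -2k + 2k = 0`; this is
`coord_flat_and_harmonic`. Harmonicity passes to the other two metrics because the Laplacian of a
conformal metric is a multiple of `Δ` (`coordLaplacian_conformal`).

The curvature and Laplacian formulas are proved in coordinates, as polynomial identities after
clearing determinants. -/

namespace ChernRicci

/-- The partial derivative of a vector valued function on the plane. -/
noncomputable def vderiv {F : Type*} [NormedAddCommGroup F] [NormedSpace ℝ F] (i : Fin 2)
    (f : E2 → F) (x : E2) : F :=
  fderiv ℝ f x (coordVec i)

/-! ### Rules for partial derivatives on the plane. -/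

section Calculus

variable {F : Type*} [NormedAddCommGroup F] [NormedSpace ℝ F] {U : Set E2} {x : E2}

theorem pderiv_eq_vderiv (i : Fin 2) (f : E2 → ℝ) : pderiv i f = vderiv i f := rfl

theorem differentiableAt_of_contDiffOn {f : E2 → F} (hU : IsOpen U) (hf : ContDiffOn ℝ ∞ f U)
    (hx : x ∈ U) : DifferentiableAt ℝ f x :=
  (hf.contDiffAt (hU.mem_nhds hx)).differentiableAt (by simp)

theorem contDiffOn_vderiv {f : E2 → F} (hU : IsOpen U) (hf : ContDiffOn ℝ ∞ f U) (i : Fin 2) :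
    ContDiffOn ℝ ∞ (vderiv i f) U :=
  (hf.fderiv_of_isOpen hU (by simp)).clm_apply contDiffOn_const

theorem vderiv_congr {f g : E2 → F} (hU : IsOpen U) (h : Set.EqOn f g U) (hx : x ∈ U)
    (i : Fin 2) : vderiv i f x = vderiv i g x := by
  have : f =ᶠ[nhds x] g := Filter.eventuallyEq_of_mem (hU.mem_nhds hx) h
  simp only [vderiv, this.fderiv_eq]

theorem vderiv_comm {f : E2 → F} (hU : IsOpen U) (hf : ContDiffOn ℝ ∞ f U) (hx : x ∈ U)
    (i j : Fin 2) : vderiv i (vderiv j f) x = vderiv j (vderiv i f) x := by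
  have hd : DifferentiableAt ℝ (fderiv ℝ f) x :=
    differentiableAt_of_contDiffOn hU (hf.fderiv_of_isOpen hU (by simp)) hx
  have key : ∀ i j : Fin 2, vderiv i (vderiv j f) x
      = fderiv ℝ (fderiv ℝ f) x (coordVec i) (coordVec j) := by
    intro i j
    unfold vderiv
    rw [fderiv_clm_apply hd (differentiableAt_const _)]
    simp
  rw [key, key]
  have hs : IsSymmSndFDerivAt ℝ f x :=
    (hf.contDiffAt (hU.mem_nhds hx)).isSymmSndFDerivAt (by simp [ENat.LEInfty.out])
  exact hs _ _

theorem vderiv_add {f g : E2 → F} (hf : DifferentiableAt ℝ f x) (hg : DifferentiableAt ℝ g x)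
    (i : Fin 2) : vderiv i (fun y => f y + g y) x = vderiv i f x + vderiv i g x := by
  simp only [vderiv, fderiv_fun_add hf hg, add_apply]

theorem vderiv_sub {f g : E2 → F} (hf : DifferentiableAt ℝ f x) (hg : DifferentiableAt ℝ g x)
    (i : Fin 2) : vderiv i (fun y => f y - g y) x = vderiv i f x - vderiv i g x := by
  simp only [vderiv, fderiv_fun_sub hf hg, sub_apply]

theorem vderiv_const (c : F) (i : Fin 2) : vderiv i (fun _ => c) x = 0 := by
  simp [vderiv]

theorem vderiv_smul {f : E2 → ℝ} {g : E2 → F} (hf : DifferentiableAt ℝ f x)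
    (hg : DifferentiableAt ℝ g x) (i : Fin 2) :
    vderiv i (fun y => f y • g y) x = f x • vderiv i g x + vderiv i f x • g x := by
  simp [vderiv, fderiv_fun_smul hf hg]

theorem vderiv_mul {f g : E2 → ℝ} (hf : DifferentiableAt ℝ f x) (hg : DifferentiableAt ℝ g x)
    (i : Fin 2) : vderiv i (fun y => f y * g y) x = f x * vderiv i g x + vderiv i f x * g x :=
  vderiv_smul hf hg i

theorem vderiv_const_mul {g : E2 → ℝ} (hg : DifferentiableAt ℝ g x) (c : ℝ)
    (i : Fin 2) : vderiv i (fun y => c * g y) x = c * vderiv i g x := by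
  rw [vderiv_mul (differentiableAt_const c) hg, vderiv_const]; ring

theorem vderiv_inv {f : E2 → ℝ} (hf : DifferentiableAt ℝ f x) (h : f x ≠ 0) (i : Fin 2) :
    vderiv i (fun y => (f y)⁻¹) x = -vderiv i f x / f x ^ 2 := by
  have := (hasDerivAt_inv h).comp_hasFDerivAt x hf.hasFDerivAt
  have h2 : HasFDerivAt (fun y => (f y)⁻¹) _ x := this
  simp only [vderiv, h2.fderiv]
  simp; ring

theorem vderiv_log {f : E2 → ℝ} (hf : DifferentiableAt ℝ f x) (h : f x ≠ 0) (i : Fin 2) :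
    vderiv i (fun y => Real.log (f y)) x = vderiv i f x / f x := by
  have h2 := hf.hasFDerivAt.log h
  simp only [vderiv, h2.fderiv]
  simp; ring

theorem vderiv_sqrt {f : E2 → ℝ} (hf : DifferentiableAt ℝ f x) (h : f x ≠ 0) (i : Fin 2) :
    vderiv i (fun y => √(f y)) x = vderiv i f x / (2 * √(f x)) := by
  have h2 := hf.hasFDerivAt.sqrt h
  simp only [vderiv, h2.fderiv]
  simp; ring

theorem vderiv_inner {f g : E2 → E3} (hf : DifferentiableAt ℝ f x) (hg : DifferentiableAt ℝ g x)
    (i : Fin 2) :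
    vderiv i (fun y => ⟪f y, g y⟫) x = ⟪f x, vderiv i g x⟫ + ⟪vderiv i f x, g x⟫ := by
  simp only [vderiv]
  rw [fderiv_inner_apply ℝ hf hg]

end Calculus

/-! ### Metrics in coordinates -/

/-- The symmetric matrix with entries `E`, `F`, `G`. -/
def metricMatrix (E F G : E2 → ℝ) (x : E2) : Matrix (Fin 2) (Fin 2) ℝ :=
  !![E x, F x; F x, G x]

section Coordinates

variable {U : Set E2} {x : E2}

theorem det_metricMatrix (E F G : E2 → ℝ) (x : E2) :
    (metricMatrix E F G x).det = E x * G x - F x ^ 2 := by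
  simp [metricMatrix, Matrix.det_fin_two_of]; ring

theorem inv_metricMatrix (E F G : E2 → ℝ) (x : E2) :
    (metricMatrix E F G x)⁻¹ =
      (E x * G x - F x ^ 2)⁻¹ • !![G x, -F x; -F x, E x] := by
  rw [Matrix.inv_def, det_metricMatrix, Ring.inverse_eq_inv', metricMatrix,
    Matrix.adjugate_fin_two_of]

theorem christoffel_congr {G H : E2 → Matrix (Fin 2) (Fin 2) ℝ} (hU : IsOpen U)
    (h : Set.EqOn G H U) (hx : x ∈ U) (k i j : Fin 2) :
    christoffel G k i j x = christoffel H k i j x := by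
  have h' : ∀ a b, Set.EqOn (fun y => G y a b) (fun y => H y a b) U := fun a b y hy => by
    simp only [h hy]
  simp only [christoffel, pderiv_eq_vderiv, vderiv_congr hU (h' _ _) hx, h hx]

theorem coordGaussCurvature_congr {G H : E2 → Matrix (Fin 2) (Fin 2) ℝ} (hU : IsOpen U)
    (h : Set.EqOn G H U) (hx : x ∈ U) : coordGaussCurvature G x = coordGaussCurvature H x := by
  have h' : ∀ k i j, Set.EqOn (christoffel G k i j) (christoffel H k i j) U :=
    fun k i j y hy => christoffel_congr hU h hy k i j
  simp only [coordGaussCurvature, curvatureCoeff, pderiv_eq_vderiv, vderiv_congr hU (h' _ _ _) hx,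
    h hx, h' _ _ _ hx]

theorem coordLaplacian_congr {G H : E2 → Matrix (Fin 2) (Fin 2) ℝ} {f g : E2 → ℝ}
    (hU : IsOpen U) (h : Set.EqOn G H U) (hfg : Set.EqOn f g U) (hx : x ∈ U) :
    coordLaplacian G f x = coordLaplacian H g x := by
  have h' : ∀ i, Set.EqOn (fun y => √(G y).det * ∑ j, (G y)⁻¹ i j * vderiv j f y)
      (fun y => √(H y).det * ∑ j, (H y)⁻¹ i j * vderiv j g y) U := fun i y hy => by
    simp only [h hy, vderiv_congr hU hfg hy]
  simp only [coordLaplacian, pderiv_eq_vderiv, vderiv_congr hU (h' _) hx, h hx]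

/-- The Brioschi polynomial, the numerator of the Gauss curvature. -/
noncomputable def brioschi (E F G : E2 → ℝ) (x : E2) : ℝ :=
  (E x * G x - F x ^ 2) * (vderiv 0 (vderiv 1 F) x - vderiv 1 (vderiv 1 E) x / 2
      - vderiv 0 (vderiv 0 G) x / 2)
    + (G x * (vderiv 1 E x / 2) ^ 2 - 2 * F x * (vderiv 1 E x / 2) * (vderiv 0 G x / 2)
      + E x * (vderiv 0 G x / 2) ^ 2)
    - (G x * (vderiv 0 E x / 2) * (vderiv 1 F x - vderiv 0 G x / 2)
      - F x * ((vderiv 0 E x / 2) * (vderiv 1 G x / 2)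
        + (vderiv 0 F x - vderiv 1 E x / 2) * (vderiv 1 F x - vderiv 0 G x / 2))
      + E x * (vderiv 0 F x - vderiv 1 E x / 2) * (vderiv 1 G x / 2))

variable {E F G : E2 → ℝ}

theorem christoffel_metricMatrix (i j : Fin 2) (y : E2) :
    christoffel (metricMatrix E F G) 0 i j y =
      (E y * G y - F y ^ 2)⁻¹ * (1 / 2 *
        (G y * (vderiv i (fun y => metricMatrix E F G y j 0) y
          + vderiv j (fun y => metricMatrix E F G y i 0) y
          - vderiv 0 (fun y => metricMatrix E F G y i j) y)
        - F y * (vderiv i (fun y => metricMatrix E F G y j 1) y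
          + vderiv j (fun y => metricMatrix E F G y i 1) y
          - vderiv 1 (fun y => metricMatrix E F G y i j) y))) ∧
    christoffel (metricMatrix E F G) 1 i j y =
      (E y * G y - F y ^ 2)⁻¹ * (1 / 2 *
        (E y * (vderiv i (fun y => metricMatrix E F G y j 1) y
          + vderiv j (fun y => metricMatrix E F G y i 1) y
          - vderiv 1 (fun y => metricMatrix E F G y i j) y)
        - F y * (vderiv i (fun y => metricMatrix E F G y j 0) y
          + vderiv j (fun y => metricMatrix E F G y i 0) y
          - vderiv 0 (fun y => metricMatrix E F G y i j) y))) := by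
  constructor <;>
  · simp only [christoffel, inv_metricMatrix, Fin.sum_univ_two, pderiv_eq_vderiv]
    simp only [Matrix.smul_apply, Matrix.of_apply, Matrix.cons_val', Matrix.cons_val_zero,
      Matrix.cons_val_one, smul_eq_mul, Matrix.cons_val_fin_one]
    ring

theorem contDiffOn_metricMatrix (hE : ContDiffOn ℝ ∞ E U) (hF : ContDiffOn ℝ ∞ F U)
    (hG : ContDiffOn ℝ ∞ G U) (i j : Fin 2) :
    ContDiffOn ℝ ∞ (fun y => metricMatrix E F G y i j) U := by
  fin_cases i <;> fin_cases j <;> assumption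

theorem contDiffOn_christoffel (hU : IsOpen U) (hE : ContDiffOn ℝ ∞ E U)
    (hF : ContDiffOn ℝ ∞ F U) (hG : ContDiffOn ℝ ∞ G U)
    (hD : ∀ y ∈ U, E y * G y - F y ^ 2 ≠ 0) (k i j : Fin 2) :
    ContDiffOn ℝ ∞ (christoffel (metricMatrix E F G) k i j) U := by
  have hM : ∀ a b c : Fin 2, ContDiffOn ℝ ∞ (vderiv c (fun y => metricMatrix E F G y a b)) U :=
    fun a b c => contDiffOn_vderiv hU (contDiffOn_metricMatrix hE hF hG a b) c
  have hinv : ContDiffOn ℝ ∞ (fun y => (E y * G y - F y ^ 2)⁻¹) U :=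
    ((hE.mul hG).sub (hF.pow 2)).inv hD
  have key : ∀ (A B : E2 → ℝ), ContDiffOn ℝ ∞ A U → ContDiffOn ℝ ∞ B U → ∀ a b : Fin 2,
      ContDiffOn ℝ ∞ (fun y => (E y * G y - F y ^ 2)⁻¹ * (1 / 2 *
        (A y * (vderiv i (fun y => metricMatrix E F G y j a) y
          + vderiv j (fun y => metricMatrix E F G y i a) y
          - vderiv a (fun y => metricMatrix E F G y i j) y)
        - B y * (vderiv i (fun y => metricMatrix E F G y j b) y
          + vderiv j (fun y => metricMatrix E F G y i b) y
          - vderiv b (fun y => metricMatrix E F G y i j) y)))) U := by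
    intro A B hA hB a b
    exact hinv.mul (contDiffOn_const.mul ((hA.mul (((hM _ _ _).add (hM _ _ _)).sub (hM _ _ _))).sub
      (hB.mul (((hM _ _ _).add (hM _ _ _)).sub (hM _ _ _)))))
  fin_cases k
  · exact (key G F hG hF 0 1).congr fun y _ => (christoffel_metricMatrix i j y).1
  · exact (key E F hE hF 1 0).congr fun y _ => (christoffel_metricMatrix i j y).2

/-- Brioschi's formula for the Gauss curvature. -/
theorem coordGaussCurvature_mul_det_sq (hU : IsOpen U) (hE : ContDiffOn ℝ ∞ E U)
    (hF : ContDiffOn ℝ ∞ F U) (hG : ContDiffOn ℝ ∞ G U)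
    (hD : ∀ y ∈ U, E y * G y - F y ^ 2 ≠ 0) (hx : x ∈ U) :
    coordGaussCurvature (metricMatrix E F G) x * (E x * G x - F x ^ 2) ^ 2 = brioschi E F G x := by
  have hΓ : ∀ k i j, DifferentiableAt ℝ (christoffel (metricMatrix E F G) k i j) x := fun k i j =>
    differentiableAt_of_contDiffOn hU (contDiffOn_christoffel hU hE hF hG hD k i j) hx
  have dE := differentiableAt_of_contDiffOn hU hE hx
  have dF := differentiableAt_of_contDiffOn hU hF hx
  have d1E := differentiableAt_of_contDiffOn hU (contDiffOn_vderiv hU hE 1) hx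
  have d1F := differentiableAt_of_contDiffOn hU (contDiffOn_vderiv hU hF 1) hx
  have d0G := differentiableAt_of_contDiffOn hU (contDiffOn_vderiv hU hG 0) hx
  have m00 : (fun y => metricMatrix E F G y 0 0) = E := rfl
  have m01 : (fun y => metricMatrix E F G y 0 1) = F := rfl
  have m10 : (fun y => metricMatrix E F G y 1 0) = F := rfl
  have m11 : (fun y => metricMatrix E F G y 1 1) = G := rfl
  have c := fun i j y => christoffel_metricMatrix (E := E) (F := F) (G := G) i j y
  -- Lowering the upper index removes the inverse matrix: the combinations in `e1` and `e2` are
  -- Christoffel symbols of the first kind, linear in the derivatives of the metric. Differentiating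
  -- them avoids differentiating a quotient.
  have e1 : vderiv 0 (fun y => E y * christoffel (metricMatrix E F G) 0 1 1 y
      + F y * christoffel (metricMatrix E F G) 1 1 1 y) x
      = vderiv 0 (fun y => vderiv 1 F y - 1 / 2 * vderiv 0 G y) x := by
    refine vderiv_congr hU (fun y hy => ?_) hx 0
    have := hD y hy
    simp only [(c 1 1 y).1, (c 1 1 y).2, m10, m11]
    field_simp
    ring
  have e2 : vderiv 1 (fun y => E y * christoffel (metricMatrix E F G) 0 0 1 y
      + F y * christoffel (metricMatrix E F G) 1 0 1 y) x
      = vderiv 1 (fun y => 1 / 2 * vderiv 1 E y) x := by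
    refine vderiv_congr hU (fun y hy => ?_) hx 1
    have := hD y hy
    simp only [(c 0 1 y).1, (c 0 1 y).2, m00, m01, m10, m11]
    field_simp
    ring
  rw [vderiv_add (dE.fun_mul (hΓ _ _ _)) (dF.fun_mul (hΓ _ _ _)), vderiv_mul dE (hΓ _ _ _),
    vderiv_mul dF (hΓ _ _ _), vderiv_sub d1F (d0G.const_mul (1 / 2)), vderiv_const_mul d0G] at e1
  rw [vderiv_add (dE.fun_mul (hΓ _ _ _)) (dF.fun_mul (hΓ _ _ _)), vderiv_mul dE (hΓ _ _ _),
    vderiv_mul dF (hΓ _ _ _), vderiv_const_mul d1E] at e2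
  have hDx := hD x hx
  have hnum : coordGaussCurvature (metricMatrix E F G) x * (E x * G x - F x ^ 2)
      = ∑ l, metricMatrix E F G x l 0 * curvatureCoeff (metricMatrix E F G) l 0 1 1 x := by
    rw [coordGaussCurvature, det_metricMatrix, div_mul_cancel₀ _ hDx]
  rw [sq, ← mul_assoc, hnum]
  simp only [curvatureCoeff, Fin.sum_univ_two, pderiv_eq_vderiv]
  rw [show metricMatrix E F G x 0 0 = E x from rfl, show metricMatrix E F G x 1 0 = F x from rfl]
  simp only [(c _ _ x).1, (c _ _ x).2, m00, m01, m10, m11] at e1 e2 ⊢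
  unfold brioschi
  generalize vderiv 0 (christoffel (metricMatrix E F G) 0 1 1) x = a at *
  generalize vderiv 0 (christoffel (metricMatrix E F G) 1 1 1) x = b at *
  generalize vderiv 1 (christoffel (metricMatrix E F G) 0 0 1) x = a' at *
  generalize vderiv 1 (christoffel (metricMatrix E F G) 1 0 1) x = b' at *
  -- The derivatives of the Christoffel symbols enter the numerator of the curvature exactly through
  -- `e1 - e2`, so they drop out; products of first derivatives of the metric remain.
  linear_combination (norm := skip)
    (E x * G x - F x ^ 2) * e1 - (E x * G x - F x ^ 2) * e2
  field_simp
  ring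

end Coordinates

/-! ### Conformal change of metric in dimension two. -/

section Conformal

variable {U : Set E2} {x : E2} {E F G f lam : E2 → ℝ}

/-- The numerator of the Laplace–Beltrami operator in coordinates. -/
noncomputable def beltrami (E F G f : E2 → ℝ) (x : E2) : ℝ :=
  (E x * G x - F x ^ 2) * (G x * vderiv 0 (vderiv 0 f) x - 2 * F x * vderiv 0 (vderiv 1 f) x
      + E x * vderiv 1 (vderiv 1 f) x + (vderiv 0 G x - vderiv 1 F x) * vderiv 0 f x
      + (vderiv 1 E x - vderiv 0 F x) * vderiv 1 f x)
    - ((G x * vderiv 0 f x - F x * vderiv 1 f x)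
        * (E x * vderiv 0 G x + vderiv 0 E x * G x - 2 * F x * vderiv 0 F x)
      + (E x * vderiv 1 f x - F x * vderiv 0 f x)
        * (E x * vderiv 1 G x + vderiv 1 E x * G x - 2 * F x * vderiv 1 F x)) / 2

theorem vderiv_det (dE : DifferentiableAt ℝ E x) (dF : DifferentiableAt ℝ F x)
    (dG : DifferentiableAt ℝ G x) (i : Fin 2) :
    vderiv i (fun y => E y * G y - F y ^ 2) x
      = E x * vderiv i G x + vderiv i E x * G x - 2 * F x * vderiv i F x := by
  simp only [sq]
  rw [vderiv_sub (dE.fun_mul dG) (dF.fun_mul dF), vderiv_mul dE dG, vderiv_mul dF dF]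
  ring

/-- With `D` the determinant, `√D g⁻¹` is `D^(-1/2)` times the adjugate matrix. After the outer
factor `D^(-1/2)` and the product rule only `D⁻¹` and `D⁻²` occur, so `D²` clears all roots and
denominators. -/
theorem coordLaplacian_mul_det_sq (hU : IsOpen U) (hE : ContDiffOn ℝ ∞ E U)
    (hF : ContDiffOn ℝ ∞ F U) (hG : ContDiffOn ℝ ∞ G U) (hf : ContDiffOn ℝ ∞ f U)
    (hD : ∀ y ∈ U, 0 < E y * G y - F y ^ 2) (hx : x ∈ U) :
    coordLaplacian (metricMatrix E F G) f x * (E x * G x - F x ^ 2) ^ 2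
      = beltrami E F G f x := by
  have dE := differentiableAt_of_contDiffOn hU hE hx
  have dF := differentiableAt_of_contDiffOn hU hF hx
  have dG := differentiableAt_of_contDiffOn hU hG hx
  have d0 := differentiableAt_of_contDiffOn hU (contDiffOn_vderiv hU hf 0) hx
  have d1 := differentiableAt_of_contDiffOn hU (contDiffOn_vderiv hU hf 1) hx
  have hDx := hD x hx
  have dD : DifferentiableAt ℝ (fun y => E y * G y - F y ^ 2) x :=
    (dE.fun_mul dG).fun_sub (dF.fun_pow 2)
  have dS : DifferentiableAt ℝ (fun y => √(E y * G y - F y ^ 2)) x := dD.sqrt hDx.ne'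
  have hS : √(E x * G x - F x ^ 2) ≠ 0 := (Real.sqrt_pos.2 hDx).ne'
  have hSS : √(E x * G x - F x ^ 2) ^ 2 = E x * G x - F x ^ 2 := Real.sq_sqrt hDx.le
  have dI : DifferentiableAt ℝ (fun y => (√(E y * G y - F y ^ 2))⁻¹) x := dS.fun_inv hS
  have hI : ∀ i, vderiv i (fun y => (√(E y * G y - F y ^ 2))⁻¹) x
      = -(E x * vderiv i G x + vderiv i E x * G x - 2 * F x * vderiv i F x)
        / (2 * √(E x * G x - F x ^ 2) ^ 3) := by
    intro i
    rw [vderiv_inv dS hS, vderiv_sqrt dD hDx.ne', vderiv_det dE dF dG]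
    field_simp
  have a0 : vderiv 0 (fun y => √(metricMatrix E F G y).det
        * ∑ j, (metricMatrix E F G y)⁻¹ 0 j * vderiv j f y) x
      = vderiv 0 (fun y => (√(E y * G y - F y ^ 2))⁻¹
        * (G y * vderiv 0 f y - F y * vderiv 1 f y)) x := by
    refine vderiv_congr hU (fun y hy => ?_) hx 0
    have h1 : √(E y * G y - F y ^ 2) ≠ 0 := (Real.sqrt_pos.2 (hD y hy)).ne'
    have h2 := Real.sq_sqrt (hD y hy).le
    simp only [inv_metricMatrix, det_metricMatrix, Fin.sum_univ_two, Matrix.smul_apply,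
      Matrix.of_apply, Matrix.cons_val', Matrix.cons_val_zero, Matrix.cons_val_one, smul_eq_mul,
      Matrix.cons_val_fin_one]
    rw [show (E y * G y - F y ^ 2)⁻¹ = (√(E y * G y - F y ^ 2) ^ 2)⁻¹ by rw [h2]]
    field_simp
    ring
  have a1 : vderiv 1 (fun y => √(metricMatrix E F G y).det
        * ∑ j, (metricMatrix E F G y)⁻¹ 1 j * vderiv j f y) x
      = vderiv 1 (fun y => (√(E y * G y - F y ^ 2))⁻¹
        * (E y * vderiv 1 f y - F y * vderiv 0 f y)) x := by
    refine vderiv_congr hU (fun y hy => ?_) hx 1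
    have h1 : √(E y * G y - F y ^ 2) ≠ 0 := (Real.sqrt_pos.2 (hD y hy)).ne'
    have h2 := Real.sq_sqrt (hD y hy).le
    simp only [inv_metricMatrix, det_metricMatrix, Fin.sum_univ_two, Matrix.smul_apply,
      Matrix.of_apply, Matrix.cons_val', Matrix.cons_val_zero, Matrix.cons_val_one, smul_eq_mul,
      Matrix.cons_val_fin_one]
    rw [show (E y * G y - F y ^ 2)⁻¹ = (√(E y * G y - F y ^ 2) ^ 2)⁻¹ by rw [h2]]
    field_simp
    ring
  rw [coordLaplacian, det_metricMatrix]
  simp only [pderiv_eq_vderiv, Fin.sum_univ_two (f := fun i => vderiv i _ x)]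
  rw [a0, a1, vderiv_mul dI ((dG.fun_mul d0).fun_sub (dF.fun_mul d1)),
    vderiv_mul dI ((dE.fun_mul d1).fun_sub (dF.fun_mul d0)), hI, hI,
    vderiv_sub (dG.fun_mul d0) (dF.fun_mul d1), vderiv_sub (dE.fun_mul d1) (dF.fun_mul d0),
    vderiv_mul dG d0, vderiv_mul dF d1, vderiv_mul dE d1, vderiv_mul dF d0,
    vderiv_comm hU hf hx 1 0, beltrami]
  -- The root becomes a free variable `s` with `D = s²`, leaving a rational identity.
  generalize √(E x * G x - F x ^ 2) = s at *
  rw [← hSS]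
  field_simp
  ring

/-- The Laplacian of a conformally changed metric. -/
theorem coordLaplacian_conformal (hU : IsOpen U) (hE : ContDiffOn ℝ ∞ E U)
    (hF : ContDiffOn ℝ ∞ F U) (hG : ContDiffOn ℝ ∞ G U) (hf : ContDiffOn ℝ ∞ f U)
    (hl : ContDiffOn ℝ ∞ lam U) (hlam : ∀ y ∈ U, 0 < lam y)
    (hD : ∀ y ∈ U, 0 < E y * G y - F y ^ 2) (hx : x ∈ U) :
    lam x * coordLaplacian (fun y => lam y • metricMatrix E F G y) f x
      = coordLaplacian (metricMatrix E F G) f x := by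
  have hm : (fun y => lam y • metricMatrix E F G y)
      = metricMatrix (fun y => lam y * E y) (fun y => lam y * F y) (fun y => lam y * G y) := by
    funext y; simp [metricMatrix]
  have dE := differentiableAt_of_contDiffOn hU hE hx
  have dF := differentiableAt_of_contDiffOn hU hF hx
  have dG := differentiableAt_of_contDiffOn hU hG hx
  have dl := differentiableAt_of_contDiffOn hU hl hx
  have h1 := coordLaplacian_mul_det_sq hU hE hF hG hf hD hx
  have h2 := coordLaplacian_mul_det_sq hU (hl.mul hE) (hl.mul hF) (hl.mul hG) hf
    (fun y hy => by
      have := mul_pos (pow_pos (hlam y hy) 2) (hD y hy)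
      linarith only [this]) hx
  rw [hm]
  -- `beltrami` is homogeneous of degree three in the metric, and the derivatives of `lam` cancel:
  -- this is the conformal invariance of `√(det g) g⁻¹` in dimension two.
  have h3 : beltrami (fun y => lam y * E y) (fun y => lam y * F y) (fun y => lam y * G y) f x
      = lam x ^ 3 * beltrami E F G f x := by
    simp only [beltrami, vderiv_mul dl dE, vderiv_mul dl dF, vderiv_mul dl dG]
    ring
  have hDx := (hD x hx).ne'
  have hlx := (hlam x hx).ne'
  refine mul_right_cancel₀ (pow_ne_zero 2 hDx) (mul_left_cancel₀ (pow_ne_zero 3 hlx) ?_)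
  rw [h1, ← h3]
  refine Eq.trans ?_ h2
  ring

/-- The Gauss curvature of a conformally changed metric. -/
theorem coordGaussCurvature_conformal (hU : IsOpen U) (hE : ContDiffOn ℝ ∞ E U)
    (hF : ContDiffOn ℝ ∞ F U) (hG : ContDiffOn ℝ ∞ G U)
    (hl : ContDiffOn ℝ ∞ lam U) (hlam : ∀ y ∈ U, 0 < lam y)
    (hD : ∀ y ∈ U, 0 < E y * G y - F y ^ 2) (hx : x ∈ U) :
    lam x * coordGaussCurvature (fun y => lam y • metricMatrix E F G y) x
      = coordGaussCurvature (metricMatrix E F G) x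
        - coordLaplacian (metricMatrix E F G) (fun y => Real.log (lam y)) x / 2 := by
  have hm : (fun y => lam y • metricMatrix E F G y)
      = metricMatrix (fun y => lam y * E y) (fun y => lam y * F y) (fun y => lam y * G y) := by
    funext y; simp [metricMatrix]
  have hD' : ∀ y ∈ U, lam y * E y * (lam y * G y) - (lam y * F y) ^ 2 ≠ 0 := fun y hy => by
    have := mul_pos (pow_pos (hlam y hy) 2) (hD y hy)
    refine ne_of_gt ?_
    linarith only [this]
  have hw : ContDiffOn ℝ ∞ (fun y => Real.log (lam y)) U := hl.log fun y hy => (hlam y hy).ne'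
  have h1 := coordLaplacian_mul_det_sq hU hE hF hG hw hD hx
  have h2 := coordGaussCurvature_mul_det_sq hU hE hF hG (fun y hy => (hD y hy).ne') hx
  have h3 := coordGaussCurvature_mul_det_sq hU (hl.mul hE) (hl.mul hF) (hl.mul hG) hD' hx
  rw [hm]
  set w : E2 → ℝ := fun y => Real.log (lam y) with hwdef
  have dl : ∀ y ∈ U, DifferentiableAt ℝ lam y := fun y => differentiableAt_of_contDiffOn hU hl
  -- Derivatives of `lam` are expressed through `w = log lam`, so that each derivative of `lam * A`
  -- is `lam` times a polynomial and powers of `lam` factor out.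
  have dlw : ∀ i, Set.EqOn (vderiv i lam) (fun y => lam y * vderiv i w y) U := by
    intro i y hy
    have := vderiv_log (dl y hy) (hlam y hy).ne' i
    have hne := (hlam y hy).ne'
    simp only [hwdef, this]
    field_simp
  have dw : ∀ i, DifferentiableAt ℝ (vderiv i w) x := fun i =>
    differentiableAt_of_contDiffOn hU (contDiffOn_vderiv hU hw i) hx
  have ddl : ∀ i j, vderiv i (vderiv j lam) x
      = lam x * (vderiv i (vderiv j w) x + vderiv i w x * vderiv j w x) := by
    intro i j
    rw [vderiv_congr hU (dlw j) hx, vderiv_mul (dl x hx) (dw j), dlw i hx]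
    ring
  have d1 : ∀ A : E2 → ℝ, ContDiffOn ℝ ∞ A U → ∀ i, Set.EqOn (vderiv i (fun y => lam y * A y))
      (fun y => lam y * vderiv i A y + vderiv i lam y * A y) U := fun A hA i y hy =>
    vderiv_mul (dl y hy) (differentiableAt_of_contDiffOn hU hA hy) i
  have d1' : ∀ A : E2 → ℝ, ContDiffOn ℝ ∞ A U → ∀ i, vderiv i (fun y => lam y * A y) x
      = lam x * (vderiv i A x + vderiv i w x * A x) := fun A hA i => by
    rw [d1 A hA i hx]; simp only [dlw i hx]; ring
  have d2 : ∀ A : E2 → ℝ, ContDiffOn ℝ ∞ A U → ∀ i j,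
      vderiv i (vderiv j (fun y => lam y * A y)) x
      = lam x * (vderiv i (vderiv j A) x + vderiv i w x * vderiv j A x
        + vderiv j w x * vderiv i A x
        + (vderiv i (vderiv j w) x + vderiv i w x * vderiv j w x) * A x) := fun A hA i j => by
    have dA := differentiableAt_of_contDiffOn hU hA hx
    have dA' := differentiableAt_of_contDiffOn hU (contDiffOn_vderiv hU hA j) hx
    have dl' := differentiableAt_of_contDiffOn hU (contDiffOn_vderiv hU hl j) hx
    rw [vderiv_congr hU (d1 A hA j) hx, vderiv_add ((dl x hx).fun_mul dA') (dl'.fun_mul dA),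
      vderiv_mul (dl x hx) dA', vderiv_mul dl' dA, ddl, dlw i hx, dlw j hx]
    ring
  -- The conformal curvature formula with denominators cleared; the terms quadratic in the
  -- derivatives of `w` cancel.
  have h4 : brioschi (fun y => lam y * E y) (fun y => lam y * F y) (fun y => lam y * G y) x
      = lam x ^ 3 * (brioschi E F G x - beltrami E F G w x / 2) := by
    simp only [brioschi, beltrami, d1' E hE, d1' F hF, d1' G hG, d2 E hE, d2 F hF, d2 G hG]
    ring
  have hDx := (hD x hx).ne'
  have hlx := (hlam x hx).ne'
  refine mul_right_cancel₀ (pow_ne_zero 2 hDx) (mul_left_cancel₀ (pow_ne_zero 3 hlx) ?_)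
  rw [sub_mul, h2, div_mul_eq_mul_div, h1, ← h4]
  refine Eq.trans ?_ h3
  ring

end Conformal

/-! ### The Gauss equation and the third fundamental form. -/

section Gauss

theorem inner_E3 (a b : E3) : ⟪a, b⟫ = a 0 * b 0 + a 1 * b 1 + a 2 * b 2 := by
  simp only [PiLp.inner_apply, Fin.sum_univ_three, RCLike.inner_apply, conj_trivial]
  ring

/-- Inner products in the basis of two vectors and a common unit normal. -/
theorem inner_mul_gram {n u v : E3} (hn : ⟪n, n⟫ = 1) (hu : ⟪n, u⟫ = 0) (hv : ⟪n, v⟫ = 0)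
    (hD : ⟪u, u⟫ * ⟪v, v⟫ - ⟪u, v⟫ ^ 2 ≠ 0) (a b : E3) :
    ⟪a, b⟫ * (⟪u, u⟫ * ⟪v, v⟫ - ⟪u, v⟫ ^ 2)
      = ⟪n, a⟫ * ⟪n, b⟫ * (⟪u, u⟫ * ⟪v, v⟫ - ⟪u, v⟫ ^ 2)
        + (⟪v, v⟫ * ⟪a, u⟫ * ⟪b, u⟫ - ⟪u, v⟫ * (⟪a, u⟫ * ⟪b, v⟫ + ⟪a, v⟫ * ⟪b, u⟫)
          + ⟪u, u⟫ * ⟪a, v⟫ * ⟪b, v⟫) := by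
  set D := ⟪u, u⟫ * ⟪v, v⟫ - ⟪u, v⟫ ^ 2 with hDdef
  -- `c` is `D` times the difference between `a` and its expansion in `n, u, v`, with tangential
  -- coefficients from Cramer's rule for the Gram matrix. It is orthogonal to all three vectors,
  -- hence zero, and pairing it with `b` gives the claim.
  set c : E3 := D • a - (D * ⟪n, a⟫) • n - (⟪v, v⟫ * ⟪a, u⟫ - ⟪u, v⟫ * ⟪a, v⟫) • u
    - (⟪u, u⟫ * ⟪a, v⟫ - ⟪u, v⟫ * ⟪a, u⟫) • v with hc
  have c1 : ⟪n, c⟫ = 0 := by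
    simp only [hc, inner_sub_right, inner_smul_right, hu, hv, hn]; ring
  have c2 : ⟪u, c⟫ = 0 := by
    simp only [hc, inner_sub_right, inner_smul_right, real_inner_comm n u, hu,
      real_inner_comm a u]
    rw [hDdef]; ring
  have c3 : ⟪v, c⟫ = 0 := by
    simp only [hc, inner_sub_right, inner_smul_right, real_inner_comm n v, hv,
      real_inner_comm a v, real_inner_comm u v]
    rw [hDdef]; ring
  have hc0 : c = 0 := by
    let M : Matrix (Fin 3) (Fin 3) ℝ := !![n 0, n 1, n 2; u 0, u 1, u 2; v 0, v 1, v 2]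
    -- The square of the determinant with rows `n, u, v` is their Gram determinant, so these vectors
    -- are independent.
    have hdet : M.det ^ 2 = D := by
      have : M.det ^ 2 = ⟪n, n⟫ * D - ⟪n, u⟫ * (⟪n, u⟫ * ⟪v, v⟫ - ⟪u, v⟫ * ⟪n, v⟫)
          + ⟪n, v⟫ * (⟪n, u⟫ * ⟪u, v⟫ - ⟪u, u⟫ * ⟪n, v⟫) := by
        rw [hDdef, Matrix.det_fin_three]
        simp only [inner_E3, M, Matrix.of_apply, Matrix.cons_val', Matrix.cons_val_zero,
          Matrix.cons_val_one, Matrix.cons_val_fin_one, Matrix.cons_val]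
        ring
      rw [this, hn, hu, hv]; ring
    have hM : M.det ≠ 0 := fun h => hD (by rw [← hdet, h]; simp)
    have hz : M.mulVec (fun i => c i) = 0 := by
      rw [inner_E3] at c1 c2 c3
      funext i
      fin_cases i <;> simp [M, Matrix.mulVec, dotProduct, Fin.sum_univ_three] <;> linarith
    ext i
    exact congrFun (Matrix.eq_zero_of_mulVec_eq_zero hM hz) i
  have hb : ⟪c, b⟫ = 0 := by rw [hc0, inner_zero_left]
  simp only [hc, inner_sub_left, inner_smul_left, conj_trivial, real_inner_comm b u,
    real_inner_comm b v] at hb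
  linear_combination hb

variable {U : Set E2} {x : E2} {Y : E2 → E3}

/-- The first fundamental form of a parametrized surface. -/
noncomputable def paramMetric (Y : E2 → E3) : E2 → Matrix (Fin 2) (Fin 2) ℝ :=
  metricMatrix (fun y => ⟪vderiv 0 Y y, vderiv 0 Y y⟫) (fun y => ⟪vderiv 0 Y y, vderiv 1 Y y⟫)
    (fun y => ⟪vderiv 1 Y y, vderiv 1 Y y⟫)

/-- The Gauss equation of a parametrized surface. -/
theorem coordGaussCurvature_paramMetric (hU : IsOpen U) (hY : ContDiffOn ℝ ∞ Y U)
    (hD : ∀ y ∈ U, ⟪vderiv 0 Y y, vderiv 0 Y y⟫ * ⟪vderiv 1 Y y, vderiv 1 Y y⟫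
      - ⟪vderiv 0 Y y, vderiv 1 Y y⟫ ^ 2 ≠ 0) (hx : x ∈ U) {n : E3} (hn : ⟪n, n⟫ = 1)
    (hn' : ∀ i, ⟪n, vderiv i Y x⟫ = 0) :
    coordGaussCurvature (paramMetric Y) x * (⟪vderiv 0 Y x, vderiv 0 Y x⟫
        * ⟪vderiv 1 Y x, vderiv 1 Y x⟫ - ⟪vderiv 0 Y x, vderiv 1 Y x⟫ ^ 2)
      = ⟪n, vderiv 0 (vderiv 0 Y) x⟫ * ⟪n, vderiv 1 (vderiv 1 Y) x⟫
        - ⟪n, vderiv 0 (vderiv 1 Y) x⟫ ^ 2 := by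
  have hY1 : ∀ i, ContDiffOn ℝ ∞ (vderiv i Y) U := contDiffOn_vderiv hU hY
  have hY2 : ∀ i j, ContDiffOn ℝ ∞ (vderiv i (vderiv j Y)) U := fun i j =>
    contDiffOn_vderiv hU (hY1 j) i
  have hI : ∀ i j, ContDiffOn ℝ ∞ (fun y => ⟪vderiv i Y y, vderiv j Y y⟫) U := fun i j =>
    (hY1 i).inner ℝ (hY1 j)
  have D1 : ∀ i, ∀ y ∈ U, DifferentiableAt ℝ (vderiv i Y) y := fun i y hy =>
    differentiableAt_of_contDiffOn hU (hY1 i) hy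
  have D2 : ∀ i j, DifferentiableAt ℝ (vderiv i (vderiv j Y)) x := fun i j =>
    differentiableAt_of_contDiffOn hU (hY2 i j) hx
  have e1 : ∀ i j k, Set.EqOn (vderiv k (fun y => ⟪vderiv i Y y, vderiv j Y y⟫))
      (fun y => ⟪vderiv i Y y, vderiv k (vderiv j Y) y⟫ + ⟪vderiv k (vderiv i Y) y, vderiv j Y y⟫)
      U := fun i j k y hy => vderiv_inner (D1 i y hy) (D1 j y hy) k
  have e2 : ∀ i j k l, vderiv l (vderiv k (fun y => ⟪vderiv i Y y, vderiv j Y y⟫)) x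
      = (⟪vderiv i Y x, vderiv l (vderiv k (vderiv j Y)) x⟫
        + ⟪vderiv l (vderiv i Y) x, vderiv k (vderiv j Y) x⟫)
        + (⟪vderiv k (vderiv i Y) x, vderiv l (vderiv j Y) x⟫
        + ⟪vderiv l (vderiv k (vderiv i Y)) x, vderiv j Y x⟫) := fun i j k l => by
    rw [vderiv_congr hU (e1 i j k) hx,
      vderiv_add ((D1 i x hx).inner ℝ (D2 k j)) ((D2 k i).inner ℝ (D1 j x hx)),
      vderiv_inner (D1 i x hx) (D2 k j), vderiv_inner (D2 k i) (D1 j x hx)]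
  have s1 : vderiv 1 (vderiv 0 Y) x = vderiv 0 (vderiv 1 Y) x := vderiv_comm hU hY hx 1 0
  have s2 : vderiv 1 (vderiv 1 (vderiv 0 Y)) x = vderiv 0 (vderiv 1 (vderiv 1 Y)) x := by
    rw [vderiv_congr hU (fun y hy => vderiv_comm hU hY hy 1 0) hx, vderiv_comm hU (hY1 1) hx 1 0]
  have s3 : vderiv 0 (vderiv 1 (vderiv 0 Y)) x = vderiv 0 (vderiv 0 (vderiv 1 Y)) x :=
    vderiv_congr hU (fun y hy => vderiv_comm hU hY hy 1 0) hx 0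
  have hB := coordGaussCurvature_mul_det_sq hU (hI 0 0) (hI 0 1) (hI 1 1) hD hx
  -- In Brioschi's polynomial the third derivatives of `Y` cancel, and its second-order part is the
  -- Gram determinant times `⟨Y₀₀, Y₁₁⟩ - ⟨Y₀₁, Y₀₁⟩`. Splitting these products into normal and
  -- tangential parts, the tangential ones cancel the first-order terms of the polynomial.
  have g1 := inner_mul_gram hn (hn' 0) (hn' 1) (hD x hx) (vderiv 0 (vderiv 0 Y) x)
    (vderiv 1 (vderiv 1 Y) x)
  have g2 := inner_mul_gram hn (hn' 0) (hn' 1) (hD x hx) (vderiv 0 (vderiv 1 Y) x)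
    (vderiv 0 (vderiv 1 Y) x)
  have hDx := hD x hx
  refine mul_right_cancel₀ hDx ?_
  rw [mul_assoc, ← sq]
  refine hB.trans ?_
  simp only [brioschi, e2, e1 _ _ _ hx, s1, s2, s3]
  generalize vderiv 0 (vderiv 0 (vderiv 1 Y)) x = T at *
  generalize vderiv 0 (vderiv 1 (vderiv 1 Y)) x = T' at *
  generalize vderiv 0 (vderiv 0 Y) x = A at *
  generalize vderiv 0 (vderiv 1 Y) x = B at *
  generalize vderiv 1 (vderiv 1 Y) x = C at *
  generalize vderiv 0 Y x = a at *
  generalize vderiv 1 Y x = b at *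
  simp only [real_inner_comm a A, real_inner_comm a B, real_inner_comm a C, real_inner_comm b A,
    real_inner_comm b B, real_inner_comm b C, real_inner_comm a T',
    real_inner_comm b T] at g1 g2 ⊢
  linear_combination g1 - g2

/-- On a minimal surface the third fundamental form is `-K` times the first one. -/
theorem thirdForm_of_minimal {n u v p q : E3} {K : ℝ} (hn : ⟪n, n⟫ = 1) (hu : ⟪n, u⟫ = 0)
    (hv : ⟪n, v⟫ = 0) (hp : ⟪n, p⟫ = 0) (hq : ⟪n, q⟫ = 0)
    (hD : ⟪u, u⟫ * ⟪v, v⟫ - ⟪u, v⟫ ^ 2 ≠ 0) (hs : ⟪p, v⟫ = ⟪q, u⟫)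
    (hH : ⟪v, v⟫ * ⟪p, u⟫ - 2 * ⟪u, v⟫ * ⟪p, v⟫ + ⟪u, u⟫ * ⟪q, v⟫ = 0)
    (hK : K * (⟪u, u⟫ * ⟪v, v⟫ - ⟪u, v⟫ ^ 2) = ⟪p, u⟫ * ⟪q, v⟫ - ⟪p, v⟫ ^ 2) :
    ⟪p, p⟫ = -K * ⟪u, u⟫ ∧ ⟪p, q⟫ = -K * ⟪u, v⟫ ∧ ⟪q, q⟫ = -K * ⟪v, v⟫ := by
  have g := inner_mul_gram hn hu hv hD
  refine ⟨mul_right_cancel₀ hD ?_, mul_right_cancel₀ hD ?_, mul_right_cancel₀ hD ?_⟩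
  -- Cayley–Hamilton, `III = 2H II - K I`, entry by entry: `hH` is weighted by the entry of `II` up
  -- to sign, `hK` by the entry of `I`.
  · rw [g, hp]
    linear_combination ⟪p, u⟫ * hH + ⟪u, u⟫ * hK
  · rw [g, hp, hq, ← hs]
    linear_combination ⟪p, v⟫ * hH + ⟪u, v⟫ * hK
  · rw [g, hq, ← hs]
    linear_combination ⟪q, v⟫ * hH + ⟪v, v⟫ * hK

end Gauss

/-! ### The linear system for the logarithms of the conformal factors. -/

section Coordinates

variable {U : Set E2} {x : E2}

theorem coordLaplacian_linear_comb {E F G f g : E2 → ℝ} (hU : IsOpen U) (hE : ContDiffOn ℝ ∞ E U)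
    (hF : ContDiffOn ℝ ∞ F U) (hG : ContDiffOn ℝ ∞ G U) (hf : ContDiffOn ℝ ∞ f U)
    (hg : ContDiffOn ℝ ∞ g U) (hD : ∀ y ∈ U, 0 < E y * G y - F y ^ 2) (hx : x ∈ U) (a b : ℝ) :
    coordLaplacian (metricMatrix E F G) (fun y => a * f y + b * g y) x
      = a * coordLaplacian (metricMatrix E F G) f x
        + b * coordLaplacian (metricMatrix E F G) g x := by
  have h1 : ∀ i, Set.EqOn (vderiv i (fun y => a * f y + b * g y))
      (fun y => a * vderiv i f y + b * vderiv i g y) U := fun i y hy => by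
    have df := differentiableAt_of_contDiffOn hU hf hy
    have dg := differentiableAt_of_contDiffOn hU hg hy
    rw [vderiv_add (df.const_mul a) (dg.const_mul b), vderiv_const_mul df, vderiv_const_mul dg]
  have h2 : ∀ i j, vderiv i (vderiv j (fun y => a * f y + b * g y)) x
      = a * vderiv i (vderiv j f) x + b * vderiv i (vderiv j g) x := fun i j => by
    have df := differentiableAt_of_contDiffOn hU (contDiffOn_vderiv hU hf j) hx
    have dg := differentiableAt_of_contDiffOn hU (contDiffOn_vderiv hU hg j) hx
    rw [vderiv_congr hU (h1 j) hx, vderiv_add (df.const_mul a) (dg.const_mul b),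
      vderiv_const_mul df, vderiv_const_mul dg]
  have hc := coordLaplacian_mul_det_sq hU hE hF hG
    ((contDiffOn_const (c := a)).mul hf |>.add ((contDiffOn_const (c := b)).mul hg)) hD hx
  have hcf := coordLaplacian_mul_det_sq hU hE hF hG hf hD hx
  have hcg := coordLaplacian_mul_det_sq hU hE hF hG hg hD hx
  refine mul_right_cancel₀ (pow_ne_zero 2 (hD x hx).ne') (hc.trans ?_)
  rw [add_mul, mul_assoc, mul_assoc, hcf, hcg]
  simp only [beltrami, h1 _ hx, h2]
  ring

/-- Flatness and harmonicity in coordinates: `k` is minus the Gauss curvature of a metric, the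
metric `k g` has curvature one and the metric `(k / t²) g` is flat. -/
theorem coord_flat_and_harmonic {E F G k t : E2 → ℝ} (hU : IsOpen U) (hE : ContDiffOn ℝ ∞ E U)
    (hF : ContDiffOn ℝ ∞ F U) (hG : ContDiffOn ℝ ∞ G U) (hk : ContDiffOn ℝ ∞ k U)
    (ht : ContDiffOn ℝ ∞ t U) (hD : ∀ y ∈ U, 0 < E y * G y - F y ^ 2) (hk0 : ∀ y ∈ U, 0 < k y)
    (ht0 : ∀ y ∈ U, 0 < t y) (hx : x ∈ U)
    (h1 : coordGaussCurvature (metricMatrix E F G) x = -k x)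
    (h2 : coordGaussCurvature (fun y => k y • metricMatrix E F G y) x = 1)
    (h3 : coordGaussCurvature (fun y => (k y / t y ^ 2) • metricMatrix E F G y) x = 0) :
    coordGaussCurvature (fun y => √(k y) • metricMatrix E F G y) x = 0 ∧
    coordGaussCurvature (fun y => t y ^ 2 • metricMatrix E F G y) x = 0 ∧
    coordLaplacian (metricMatrix E F G) (fun y => Real.log (t y ^ 2 / √(k y))) x = 0 ∧
    coordLaplacian (fun y => √(k y) • metricMatrix E F G y)
      (fun y => Real.log (t y ^ 2 / √(k y))) x = 0 ∧
    coordLaplacian (fun y => t y ^ 2 • metricMatrix E F G y)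
      (fun y => Real.log (t y ^ 2 / √(k y))) x = 0 := by
  have lk : ContDiffOn ℝ ∞ (fun y => Real.log (k y)) U := hk.log fun y hy => (hk0 y hy).ne'
  have lt : ContDiffOn ℝ ∞ (fun y => Real.log (t y)) U := ht.log fun y hy => (ht0 y hy).ne'
  have sk : ContDiffOn ℝ ∞ (fun y => √(k y)) U := hk.sqrt fun y hy => (hk0 y hy).ne'
  have sk0 : ∀ y ∈ U, 0 < √(k y) := fun y hy => Real.sqrt_pos.2 (hk0 y hy)
  have tt0 : ∀ y ∈ U, 0 < t y ^ 2 := fun y hy => pow_pos (ht0 y hy) 2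
  have tt : ContDiffOn ℝ ∞ (fun y => t y ^ 2) U := ht.pow 2
  have kt : ContDiffOn ℝ ∞ (fun y => k y / t y ^ 2) U := hk.div tt fun y hy => (tt0 y hy).ne'
  have ls : ContDiffOn ℝ ∞ (fun y => Real.log (t y ^ 2 / √(k y))) U :=
    (tt.div sk fun y hy => (sk0 y hy).ne').log fun y hy => (div_pos (tt0 y hy) (sk0 y hy)).ne'
  have lin : ∀ (w : E2 → ℝ) (a b : ℝ),
      (∀ y ∈ U, w y = a * Real.log (k y) + b * Real.log (t y)) →
      coordLaplacian (metricMatrix E F G) w x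
        = a * coordLaplacian (metricMatrix E F G) (fun y => Real.log (k y)) x
          + b * coordLaplacian (metricMatrix E F G) (fun y => Real.log (t y)) x := by
    intro w a b hw
    rw [← coordLaplacian_linear_comb hU hE hF hG lk lt hD hx]
    exact coordLaplacian_congr hU (fun _ _ => rfl) hw hx
  -- All logarithms involved are combinations of `log k` and `log t`, so only two Laplacians are
  -- unknown.
  have l1 := lin (fun y => Real.log (k y / t y ^ 2)) 1 (-2) fun y hy => by
    rw [Real.log_div (hk0 y hy).ne' (tt0 y hy).ne', Real.log_pow]; push_cast; ring
  have l2 := lin (fun y => Real.log √(k y)) (1 / 2) 0 fun y hy => by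
    rw [Real.log_sqrt (hk0 y hy).le]; ring
  have l3 := lin (fun y => Real.log (t y ^ 2)) 0 2 fun y hy => by
    rw [Real.log_pow]; push_cast; ring
  have l4 := lin (fun y => Real.log (t y ^ 2 / √(k y))) (-1 / 2) 2 fun y hy => by
    rw [Real.log_div (tt0 y hy).ne' (sk0 y hy).ne', Real.log_pow, Real.log_sqrt (hk0 y hy).le]
    push_cast; ring
  have c1 := coordGaussCurvature_conformal hU hE hF hG hk hk0 hD hx
  have c2 := coordGaussCurvature_conformal hU hE hF hG kt
    (fun y hy => div_pos (hk0 y hy) (tt0 y hy)) hD hx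
  have c3 := coordGaussCurvature_conformal hU hE hF hG sk sk0 hD hx
  have c4 := coordGaussCurvature_conformal hU hE hF hG tt tt0 hD hx
  -- Now `c1` says `Δ log k = -4k`, and with it `c2` says `Δ log t = -k`; everything else follows
  -- linearly.
  rw [h1, h2] at c1
  rw [h1, h3, l1] at c2
  rw [h1, l2] at c3
  rw [h1, l3] at c4
  have e : coordLaplacian (metricMatrix E F G) (fun y => Real.log (t y ^ 2 / √(k y))) x = 0 := by
    rw [l4]; linarith
  refine ⟨?_, ?_, e, ?_, ?_⟩
  · refine (mul_eq_zero.1 (c3.trans ?_)).resolve_left (sk0 x hx).ne'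
    linarith
  · refine (mul_eq_zero.1 (c4.trans ?_)).resolve_left (tt0 x hx).ne'
    linarith
  · exact (mul_eq_zero.1 ((coordLaplacian_conformal hU hE hF hG ls sk sk0 hD hx).trans
      e)).resolve_left (sk0 x hx).ne'
  · exact (mul_eq_zero.1 ((coordLaplacian_conformal hU hE hF hG ls tt tt0 hD hx).trans
      e)).resolve_left (tt0 x hx).ne'

end Coordinates

/-! ### Immersions into the sphere and the plane, and stereographic projection. -/

section Parametrized

variable {U : Set E2} {x : E2} {Y n : E2 → E3}

/-- The Gram determinant of the partial derivatives. -/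
noncomputable def gramDet (Y : E2 → E3) (y : E2) : ℝ :=
  ⟪vderiv 0 Y y, vderiv 0 Y y⟫ * ⟪vderiv 1 Y y, vderiv 1 Y y⟫ - ⟪vderiv 0 Y y, vderiv 1 Y y⟫ ^ 2

/-- The equality case of Cauchy–Schwarz: `e * gramDet` is the squared norm of `f Y₀ - e Y₁`, which
injectivity keeps away from zero. -/
theorem gramDet_pos (h : Function.Injective (fderiv ℝ Y x)) : 0 < gramDet Y x := by
  have hE : 0 < ⟪vderiv 0 Y x, vderiv 0 Y x⟫ := by
    rw [real_inner_self_pos]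
    intro h0
    have : coordVec 0 = 0 := h (by rw [map_zero]; exact h0)
    simp [coordVec] at this
  set e := ⟪vderiv 0 Y x, vderiv 0 Y x⟫ with he
  set f := ⟪vderiv 0 Y x, vderiv 1 Y x⟫ with hf
  have hw : f • vderiv 0 Y x - e • vderiv 1 Y x ≠ 0 := by
    intro h0
    have h1 : f • coordVec 0 - e • coordVec 1 = 0 := h (by
      rw [map_sub, map_smul, map_smul, map_zero]; exact h0)
    have h2 := congrArg (fun v : E2 => v 1) h1
    simp [coordVec] at h2
    exact hE.ne' h2
  have hpos := real_inner_self_pos.2 hw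
  have hcalc : ⟪f • vderiv 0 Y x - e • vderiv 1 Y x, f • vderiv 0 Y x - e • vderiv 1 Y x⟫
      = e * gramDet Y x := by
    simp only [inner_sub_left, inner_sub_right, real_inner_smul_left, real_inner_smul_right,
      real_inner_comm (vderiv 0 Y x) (vderiv 1 Y x), gramDet, ← he, ← hf]
    ring
  rw [hcalc] at hpos
  exact (mul_pos_iff_of_pos_left hE).1 hpos

/-- Moves a derivative across a constant inner product. This turns normal components of second
derivatives into products of first derivatives. -/
theorem inner_vderiv_of_const {f g : E2 → E3} {c : ℝ} (hU : IsOpen U) (hf : ContDiffOn ℝ ∞ f U)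
    (hg : ContDiffOn ℝ ∞ g U) (h : ∀ y ∈ U, ⟪f y, g y⟫ = c) (hx : x ∈ U) (i : Fin 2) :
    ⟪f x, vderiv i g x⟫ = -⟪vderiv i f x, g x⟫ := by
  have := vderiv_congr hU (f := fun y => ⟪f y, g y⟫) (g := fun _ => c) h hx i
  rw [vderiv_const, vderiv_inner (differentiableAt_of_contDiffOn hU hf hx)
    (differentiableAt_of_contDiffOn hU hg hx)] at this
  linarith

theorem inner_vderiv_unit (hU : IsOpen U) (hn : ContDiffOn ℝ ∞ n U)
    (h : ∀ y ∈ U, ⟪n y, n y⟫ = 1) (hx : x ∈ U) (i : Fin 2) : ⟪n x, vderiv i n x⟫ = 0 := by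
  have := inner_vderiv_of_const hU hn hn h hx i
  rw [real_inner_comm] at this
  have h2 := real_inner_comm (n x) (vderiv i n x)
  linarith

/-- The third fundamental form of a minimal parametrized surface. -/
theorem thirdForm_param (hU : IsOpen U) (hY : ContDiffOn ℝ ∞ Y U) (hn : ContDiffOn ℝ ∞ n U)
    (hD : ∀ y ∈ U, 0 < gramDet Y y) (h1 : ∀ y ∈ U, ⟪n y, n y⟫ = 1)
    (h2 : ∀ y ∈ U, ∀ i, ⟪n y, vderiv i Y y⟫ = 0) (hx : x ∈ U)
    (hH : ⟪vderiv 1 Y x, vderiv 1 Y x⟫ * ⟪vderiv 0 n x, vderiv 0 Y x⟫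
      - ⟪vderiv 0 Y x, vderiv 1 Y x⟫ * (⟪vderiv 0 n x, vderiv 1 Y x⟫
        + ⟪vderiv 1 n x, vderiv 0 Y x⟫)
      + ⟪vderiv 0 Y x, vderiv 0 Y x⟫ * ⟪vderiv 1 n x, vderiv 1 Y x⟫ = 0) (i j : Fin 2) :
    ⟪vderiv i n x, vderiv j n x⟫
      = -coordGaussCurvature (paramMetric Y) x * ⟪vderiv i Y x, vderiv j Y x⟫ := by
  have hI : ∀ i j, ⟪n x, vderiv i (vderiv j Y) x⟫ = -⟪vderiv i n x, vderiv j Y x⟫ := fun i j =>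
    inner_vderiv_of_const hU hn (contDiffOn_vderiv hU hY j) (fun y hy => h2 y hy j) hx i
  -- Symmetry of the second fundamental form, from equality of the mixed partials of `Y`.
  have hs : ⟪vderiv 0 n x, vderiv 1 Y x⟫ = ⟪vderiv 1 n x, vderiv 0 Y x⟫ := by
    have := hI 0 1
    rw [vderiv_comm hU hY hx, hI] at this
    linarith
  have hK := coordGaussCurvature_paramMetric hU hY (fun y hy => (hD y hy).ne') hx (h1 x hx)
    (h2 x hx)
  rw [hI, hI, hI] at hK
  obtain ⟨a, b, c⟩ := thirdForm_of_minimal (h1 x hx) (h2 x hx 0) (h2 x hx 1)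
    (inner_vderiv_unit hU hn h1 hx 0) (inner_vderiv_unit hU hn h1 hx 1) (hD x hx).ne' hs
    (by linear_combination hH - ⟪vderiv 0 Y x, vderiv 1 Y x⟫ * hs) (hK.trans (by ring))
  fin_cases i <;> fin_cases j
  · exact a
  · exact b
  · exact (real_inner_comm _ _).trans (b.trans (congrArg _ (real_inner_comm _ _)))
  · exact c

/-- The metric induced by an immersion into the unit sphere has curvature one. -/
theorem coordGaussCurvature_sphere (hU : IsOpen U) (hn : ContDiffOn ℝ ∞ n U)
    (hD : ∀ y ∈ U, 0 < gramDet n y) (h1 : ∀ y ∈ U, ⟪n y, n y⟫ = 1) (hx : x ∈ U) :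
    coordGaussCurvature (paramMetric n) x = 1 := by
  have h2 : ∀ y ∈ U, ∀ i, ⟪n y, vderiv i n y⟫ = 0 := fun y hy i => inner_vderiv_unit hU hn h1 hy i
  -- The position vector is its own unit normal, so the second form is minus the first and their
  -- determinants agree.
  have hI : ∀ i j, ⟪n x, vderiv i (vderiv j n) x⟫ = -⟪vderiv i n x, vderiv j n x⟫ := fun i j =>
    inner_vderiv_of_const hU hn (contDiffOn_vderiv hU hn j) (fun y hy => h2 y hy j) hx i
  have hK := coordGaussCurvature_paramMetric hU hn (fun y hy => (hD y hy).ne') hx (h1 x hx)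
    (h2 x hx)
  rw [hI, hI, hI] at hK
  refine mul_right_cancel₀ (hD x hx).ne' (hK.trans ?_)
  rw [gramDet]; ring

/-- The metric induced by an immersion into a plane is flat. -/
theorem coordGaussCurvature_plane {V : E3} {c : ℝ} (hU : IsOpen U) (hY : ContDiffOn ℝ ∞ Y U)
    (hD : ∀ y ∈ U, 0 < gramDet Y y) (hV : ⟪V, V⟫ = 1) (h : ∀ y ∈ U, ⟪V, Y y⟫ = c) (hx : x ∈ U) :
    coordGaussCurvature (paramMetric Y) x = 0 := by
  have h2 : ∀ y ∈ U, ∀ i, ⟪V, vderiv i Y y⟫ = 0 := fun y hy i => by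
    rw [inner_vderiv_of_const hU (contDiffOn_const (c := V)) hY h hy i, vderiv_const]; simp
  have hI : ∀ i j, ⟪V, vderiv i (vderiv j Y) x⟫ = 0 := fun i j => by
    rw [inner_vderiv_of_const hU (contDiffOn_const (c := V)) (contDiffOn_vderiv hU hY j)
      (fun y hy => h2 y hy j) hx i, vderiv_const]; simp
  have hK := coordGaussCurvature_paramMetric hU hY (fun y hy => (hD y hy).ne') hx hV (h2 x hx)
  rw [hI, hI, hI] at hK
  exact mul_right_cancel₀ (hD x hx).ne' (hK.trans (by ring))

/-- Stereographic projection from `-V` onto the plane `⟪V, ·⟫ = 1`. -/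
noncomputable def stereo (V : E3) (n : E2 → E3) (y : E2) : E3 := (1 + ⟪n y, V⟫)⁻¹ • (n y + V)

theorem contDiffOn_stereo {V : E3} (hn : ContDiffOn ℝ ∞ n U) (ht : ∀ y ∈ U, 0 < 1 + ⟪n y, V⟫) :
    ContDiffOn ℝ ∞ (stereo V n) U :=
  ((contDiffOn_const.add (hn.inner ℝ contDiffOn_const)).inv fun y hy => (ht y hy).ne').smul
    (hn.add contDiffOn_const)

/-- The line from `-V` through `n` meets the plane `V^⊥` at a point whose translate by `V` is the
value of `stereo`. With this normalization the conformal factor is exactly `(1 + ⟨n, V⟩)⁻²`, without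
a factor `4`. -/
theorem inner_stereo {V : E3} (hV : ⟪V, V⟫ = 1) {y : E2} (ht : 0 < 1 + ⟪n y, V⟫) :
    ⟪V, stereo V n y⟫ = 1 := by
  rw [stereo, real_inner_smul_right, inner_add_right, hV, real_inner_comm, add_comm,
    inv_mul_cancel₀]
  rw [real_inner_comm, add_comm]
  exact ht.ne'

/-- Stereographic projection is conformal. -/
theorem inner_vderiv_stereo {V : E3} (hU : IsOpen U) (hn : ContDiffOn ℝ ∞ n U) (hV : ⟪V, V⟫ = 1)
    (h1 : ∀ y ∈ U, ⟪n y, n y⟫ = 1) (ht : ∀ y ∈ U, 0 < 1 + ⟪n y, V⟫) (hx : x ∈ U) (i j : Fin 2) :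
    ⟪vderiv i (stereo V n) x, vderiv j (stereo V n) x⟫
      = ⟪vderiv i n x, vderiv j n x⟫ / (1 + ⟪n x, V⟫) ^ 2 := by
  have dn := differentiableAt_of_contDiffOn hU hn hx
  have da : DifferentiableAt ℝ (fun y => ⟪n y, V⟫) x := dn.inner ℝ (differentiableAt_const V)
  have dt : DifferentiableAt ℝ (fun y => 1 + ⟪n y, V⟫) x := (differentiableAt_const 1).fun_add da
  have htx := (ht x hx).ne'
  have hd : ∀ i, vderiv i (stereo V n) x = (1 + ⟪n x, V⟫)⁻¹ • vderiv i n x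
      + (-⟪vderiv i n x, V⟫ / (1 + ⟪n x, V⟫) ^ 2) • (n x + V) := fun i => by
    unfold stereo
    rw [vderiv_smul (dt.fun_inv htx) (dn.fun_add (differentiableAt_const V)),
      vderiv_add dn (differentiableAt_const V), vderiv_const, vderiv_inv dt htx,
      vderiv_add (differentiableAt_const 1) da, vderiv_const,
      vderiv_inner dn (differentiableAt_const V), vderiv_const]
    simp
  have h2 : ∀ i, ⟪n x, vderiv i n x⟫ = 0 := inner_vderiv_unit hU hn h1 hx
  have h2' : ∀ i, ⟪vderiv i n x, n x⟫ = 0 := fun i => by rw [real_inner_comm, h2]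
  -- With `t = 1 + ⟨n, V⟩` and `aᵢ = ⟨∂ᵢn, V⟩`, one has `|n + V|² = 2t` and `⟨∂ᵢn, n + V⟩ = aᵢ`. The
  -- cross terms `-2 aᵢ aⱼ / t³` cancel against `2t aᵢ aⱼ / t⁴`.
  rw [hd, hd]
  simp only [inner_add_left, inner_add_right, real_inner_smul_left, real_inner_smul_right, h2, h2',
    h1 x hx, hV, real_inner_comm _ V]
  field_simp
  ring

end Parametrized

/-! ### From coordinate expressions to the surface. -/

section Manifold

variable {S : Type*} [TopologicalSpace S] [ChartedSpace E2 S]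

/-- The coordinate expression of a map in the chart around `p`. -/
noncomputable def inChart {F : Type*} (f : S → F) (p : S) : E2 → F :=
  f ∘ (extChartAt (𝓡 2) p).symm

variable {f : S → E3} {p : S} {x : E2}

theorem isOpen_chart_target (p : S) : IsOpen (extChartAt (𝓡 2) p).target :=
  isOpen_extChartAt_target p

/-- The tangent plane at `p` is identified with `ℝ²` by the chart at `p` itself, so at the centre of
that chart the coordinate frame is the standard basis used in `firstForm` and `secondForm`. -/
theorem vderiv_inChart_self (hf : MDifferentiable (𝓡 2) (𝓡 3) f) (p : S) (i : Fin 2) :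
    vderiv i (inChart f p) (extChartAt (𝓡 2) p p) = differential f p (coordVec i) := by
  rw [differential, (hf p).mfderiv]
  simp [vderiv, inChart, writtenInExtChartAt, fderivWithin_univ]
  rfl

theorem chartMatrix_conformalChange (lam : S → ℝ) (g : BilinField S) (p : S) :
    chartMatrix (conformalChange lam g) p
      = fun x => inChart lam p x • chartMatrix g p x := by
  funext x
  ext i j
  rfl

variable [IsManifold (𝓡 2) ∞ S]

theorem contDiffOn_inChart (hf : ContMDiff (𝓡 2) (𝓡 3) ∞ f) (p : S) :
    ContDiffOn ℝ ∞ (inChart f p) (extChartAt (𝓡 2) p).target := by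
  rw [← contMDiffOn_iff_contDiffOn]
  exact hf.comp_contMDiffOn (contMDiffOn_extChartAt_symm p)

theorem isInvertible_mfderiv_chart_symm (hx : x ∈ (extChartAt (𝓡 2) p).target) :
    (mfderiv (𝓡 2) (𝓡 2) (extChartAt (𝓡 2) p).symm x).IsInvertible := by
  have : IsManifold (𝓡 2) 1 S := IsManifold.of_le (n := ∞) (by simp)
  have := isInvertible_mfderivWithin_extChartAt_symm (I := 𝓡 2) hx
  rwa [show Set.range (𝓡 2) = Set.univ by simp, mfderivWithin_univ] at this

theorem fderiv_inChart (hf : MDifferentiable (𝓡 2) (𝓡 3) f)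
    (hx : x ∈ (extChartAt (𝓡 2) p).target) (v : E2) :
    fderiv ℝ (inChart f p) x v = differential f ((extChartAt (𝓡 2) p).symm x)
      (mfderiv (𝓡 2) (𝓡 2) (extChartAt (𝓡 2) p).symm x v) := by
  have : IsManifold (𝓡 2) 1 S := IsManifold.of_le (n := ∞) (by simp)
  have hs : MDifferentiableAt (𝓡 2) (𝓡 2) (extChartAt (𝓡 2) p).symm x := by
    have := mdifferentiableWithinAt_extChartAt_symm (I := 𝓡 2) hx
    rwa [show Set.range (𝓡 2) = Set.univ by simp, mdifferentiableWithinAt_univ] at this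
  rw [← mfderiv_eq_fderiv, inChart, mfderiv_comp x (hf _) hs]
  rfl

theorem vderiv_inChart (hf : MDifferentiable (𝓡 2) (𝓡 3) f)
    (hx : x ∈ (extChartAt (𝓡 2) p).target) (i : Fin 2) :
    vderiv i (inChart f p) x
      = differential f ((extChartAt (𝓡 2) p).symm x) (chartFrame p i x) :=
  fderiv_inChart hf hx _

theorem injective_fderiv_inChart (hf : MDifferentiable (𝓡 2) (𝓡 3) f)
    (hi : ∀ q, Function.Injective (differential f q)) (hx : x ∈ (extChartAt (𝓡 2) p).target) :
    Function.Injective (fderiv ℝ (inChart f p) x) := by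
  intro v w hvw
  rw [fderiv_inChart hf hx, fderiv_inChart hf hx] at hvw
  obtain ⟨e, he⟩ := isInvertible_mfderiv_chart_symm hx
  have := hi _ hvw
  rw [← he] at this
  exact e.injective this

theorem chartMatrix_inducedMetric (hf : MDifferentiable (𝓡 2) (𝓡 3) f) :
    Set.EqOn (chartMatrix (inducedMetric f) p) (paramMetric (inChart f p))
      (extChartAt (𝓡 2) p).target := by
  intro x hx
  have h : ∀ i j, inducedMetric f ((extChartAt (𝓡 2) p).symm x) (chartFrame p i x)
      (chartFrame p j x) = ⟪vderiv i (inChart f p) x, vderiv j (inChart f p) x⟫ := fun i j => by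
    rw [vderiv_inChart hf hx, vderiv_inChart hf hx]; rfl
  ext i j
  simp only [chartMatrix, Matrix.of_apply, h, paramMetric, metricMatrix]
  fin_cases i <;> fin_cases j <;> simp [real_inner_comm]

theorem isRiemannianMetric_conformalChange {lam : S → ℝ} (hf : ContMDiff (𝓡 2) (𝓡 3) ∞ f)
    (hi : ∀ q, Function.Injective (differential f q)) (hlam : ∀ q, 0 < lam q)
    (hl : ∀ q, ContDiffOn ℝ ∞ (inChart lam q) (extChartAt (𝓡 2) q).target) :
    IsRiemannianMetric (conformalChange lam (inducedMetric f)) where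
  symm p v w := by
    change lam p * ⟪differential f p v, differential f p w⟫
      = lam p * ⟪differential f p w, differential f p v⟫
    rw [real_inner_comm]
  pos p v hv := by
    change 0 < lam p * ⟪differential f p v, differential f p v⟫
    refine mul_pos (hlam p) (real_inner_self_pos.2 fun h => hv (hi p ?_))
    rw [h, map_zero]
  smooth p i j := by
    have hd : MDifferentiable (𝓡 2) (𝓡 3) f := hf.mdifferentiable (by simp)
    have hv : ∀ i, ContDiffOn ℝ ∞ (vderiv i (inChart f p)) (extChartAt (𝓡 2) p).target :=
      contDiffOn_vderiv (isOpen_chart_target p) (contDiffOn_inChart hf p)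
    have h : ContDiffOn ℝ ∞ (fun x => inChart lam p x * paramMetric (inChart f p) x i j)
        (extChartAt (𝓡 2) p).target :=
      (hl p).mul (contDiffOn_metricMatrix ((hv 0).inner ℝ (hv 0)) ((hv 0).inner ℝ (hv 1))
        ((hv 1).inner ℝ (hv 1)) i j)
    refine h.congr fun x hx => ?_
    rw [chartMatrix_conformalChange, ← chartMatrix_inducedMetric hd hx]
    rfl

theorem contMDiff_of_inChart {u : S → ℝ}
    (h : ∀ p, ContDiffOn ℝ ∞ (inChart u p) (extChartAt (𝓡 2) p).target) :
    ContMDiff (𝓡 2) 𝓘(ℝ, ℝ) 2 u := by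
  intro p
  have h2 : ContMDiffOn (𝓡 2) 𝓘(ℝ, ℝ) 2 (inChart u p) (extChartAt (𝓡 2) p).target :=
    ((h p).of_le (by simp [ENat.LEInfty.out])).contMDiffOn
  have hc : ContMDiffOn (𝓡 2) (𝓡 2) 2 (extChartAt (𝓡 2) p) (chartAt E2 p).source :=
    (contMDiffOn_extChartAt (I := 𝓡 2) (n := ∞) (x := p)).of_le (by simp [ENat.LEInfty.out])
  have h3 := h2.comp hc fun q hq => (extChartAt (𝓡 2) p).map_source (by simpa using hq)
  have h4 : ContMDiffOn (𝓡 2) 𝓘(ℝ, ℝ) 2 u (chartAt E2 p).source := h3.congr fun q hq => by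
    simp only [inChart, Function.comp]
    rw [(extChartAt (𝓡 2) p).left_inv (by simpa using hq)]
  exact h4.contMDiffAt ((chartAt E2 p).open_source.mem_nhds (mem_chart_source E2 p))

end Manifold

/-! ### Conformality of the Gauss map of a minimal surface. -/

section Minimal

theorem inner_clm_of_coordVec {A B : E2 →L[ℝ] E3} {c : ℝ}
    (h : ∀ i j, ⟪A (coordVec i), A (coordVec j)⟫ = c * ⟪B (coordVec i), B (coordVec j)⟫)
    (v w : E2) : ⟪A v, A w⟫ = c * ⟪B v, B w⟫ := by
  have hdec : ∀ v : E2, v = v 0 • coordVec 0 + v 1 • coordVec 1 := fun v => by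
    ext i; fin_cases i <;> simp [coordVec]
  rw [hdec v, hdec w]
  simp only [map_add, map_smul, inner_add_left, inner_add_right, real_inner_smul_left,
    real_inner_smul_right, h]
  ring

variable {S : Type*} [TopologicalSpace S] [ChartedSpace E2 S] [IsManifold (𝓡 2) ∞ S]
  {X N : S → E3}

/-- The computation takes place at the centre of the chart at `p`, where both curvatures are
defined. Being an identity of bilinear forms on the tangent plane, the result can then be read at
every point of any other chart, so independence of the Gauss curvature from the chart is never
needed. -/
theorem IsMinimalSurface.inner_differential (hX : IsMinimalSurface X N) (p : S)
    (v w : TangentSpace (𝓡 2) p) :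
    ⟪differential N p v, differential N p w⟫
      = -surfaceCurvature X p * ⟪differential X p v, differential X p w⟫ := by
  have hXd : MDifferentiable (𝓡 2) (𝓡 3) X := hX.smooth.mdifferentiable (by simp)
  have hNd : MDifferentiable (𝓡 2) (𝓡 3) N := hX.normal_smooth.mdifferentiable (by simp)
  have hU := isOpen_chart_target p
  have hx : extChartAt (𝓡 2) p p ∈ (extChartAt (𝓡 2) p).target := mem_extChartAt_target p
  have hD : ∀ y ∈ (extChartAt (𝓡 2) p).target, 0 < gramDet (inChart X p) y := fun y hy =>
    gramDet_pos (injective_fderiv_inChart hXd hX.immersion hy)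
  have hDx := hD _ hx
  have hKeq : coordGaussCurvature (paramMetric (inChart X p)) (extChartAt (𝓡 2) p p)
      = surfaceCurvature X p :=
    (coordGaussCurvature_congr hU (chartMatrix_inducedMetric hXd) hx).symm
  have eX := vderiv_inChart_self hXd p
  have eN := vderiv_inChart_self hNd p
  have hH := hX.minimal p
  rw [meanCurvature] at hH
  have hbasis : ∀ i j : Fin 2, ⟪differential N p (coordVec i), differential N p (coordVec j)⟫
      = -surfaceCurvature X p
        * ⟪differential X p (coordVec i), differential X p (coordVec j)⟫ := by
    intro i j
    rw [← eX, ← eX, ← eN, ← eN, ← hKeq]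
    refine thirdForm_param hU (contDiffOn_inChart hX.smooth p)
      (contDiffOn_inChart hX.normal_smooth p) hD (fun y _ => ?_) (fun y hy i => ?_) hx ?_ i j
    · rw [real_inner_self_eq_norm_sq, inChart, Function.comp, hX.normal_unit]; norm_num
    · rw [vderiv_inChart hXd hy]
      exact hX.normal_orth _ _
    · rw [gramDet] at hDx
      simp only [eX, eN] at hDx ⊢
      have h1 : firstForm X p = metricMatrix
          (fun _ => ⟪differential X p (coordVec 0), differential X p (coordVec 0)⟫)
          (fun _ => ⟪differential X p (coordVec 0), differential X p (coordVec 1)⟫)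
          (fun _ => ⟪differential X p (coordVec 1), differential X p (coordVec 1)⟫) 0 := by
        ext i j
        fin_cases i <;> fin_cases j <;> simp [firstForm, metricMatrix, real_inner_comm]
      rw [h1, inv_metricMatrix] at hH
      simp only [secondForm, Matrix.trace_fin_two, Matrix.mul_apply, Fin.sum_univ_two,
        Matrix.smul_apply, Matrix.of_apply, Matrix.cons_val', Matrix.cons_val_zero,
        Matrix.cons_val_one, Matrix.cons_val_fin_one, smul_eq_mul] at hH
      field_simp at hH
      linear_combination -hH
  exact inner_clm_of_coordVec hbasis v w

end Minimal

/-! ### Smoothness of the curvature, flatness and harmonicity in a chart. -/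

section Minimal

variable {S : Type*} [TopologicalSpace S] [ChartedSpace E2 S] [IsManifold (𝓡 2) ∞ S]
  {X N : S → E3} {V : E3}

theorem IsMinimalSurface.inner_vderiv_inChart (hX : IsMinimalSurface X N) {p : S} {x : E2}
    (hx : x ∈ (extChartAt (𝓡 2) p).target) (i j : Fin 2) :
    ⟪vderiv i (inChart N p) x, vderiv j (inChart N p) x⟫
      = inChart (fun q => -surfaceCurvature X q) p x
        * ⟪vderiv i (inChart X p) x, vderiv j (inChart X p) x⟫ := by
  have hXd : MDifferentiable (𝓡 2) (𝓡 3) X := hX.smooth.mdifferentiable (by simp)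
  have hNd : MDifferentiable (𝓡 2) (𝓡 3) N := hX.normal_smooth.mdifferentiable (by simp)
  rw [vderiv_inChart hXd hx, vderiv_inChart hXd hx, vderiv_inChart hNd hx, vderiv_inChart hNd hx]
  exact hX.inner_differential _ _ _

theorem IsMinimalSurface.gramDet_pos (hX : IsMinimalSurface X N) {p : S} {x : E2}
    (hx : x ∈ (extChartAt (𝓡 2) p).target) : 0 < gramDet (inChart X p) x :=
  ChernRicci.gramDet_pos
    (injective_fderiv_inChart (hX.smooth.mdifferentiable (by simp)) hX.immersion hx)

/-- By definition the curvature at each point uses that point's own chart, which hides its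
smoothness. Within a single chart it is recovered as the smooth quotient `-K = |∂₀N|² / |∂₀X|²`. -/
theorem IsMinimalSurface.contDiffOn_curvature (hX : IsMinimalSurface X N) (p : S) :
    ContDiffOn ℝ ∞ (inChart (fun q => -surfaceCurvature X q) p) (extChartAt (𝓡 2) p).target := by
  have hU := isOpen_chart_target p
  have hx0 := contDiffOn_vderiv hU (contDiffOn_inChart hX.smooth p) 0
  have hn0 := contDiffOn_vderiv hU (contDiffOn_inChart hX.normal_smooth p) 0
  have hne : ∀ x ∈ (extChartAt (𝓡 2) p).target,
      ⟪vderiv 0 (inChart X p) x, vderiv 0 (inChart X p) x⟫ ≠ 0 := fun x hx h => by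
    have := hX.gramDet_pos hx
    rw [gramDet, h] at this
    nlinarith only [this, sq_nonneg ⟪vderiv 0 (inChart X p) x, vderiv 1 (inChart X p) x⟫]
  refine ((hn0.inner ℝ hn0).div (hx0.inner ℝ hx0) hne).congr fun x hx => ?_
  rw [Pi.div_apply, hX.inner_vderiv_inChart hx, mul_div_cancel_right₀ _ (hne x hx)]

theorem IsMinimalSurface.contDiffOn_angle (hX : IsMinimalSurface X N) (V : E3) (p : S) :
    ContDiffOn ℝ ∞ (inChart (fun q => 1 + angle N V q) p) (extChartAt (𝓡 2) p).target :=
  contDiffOn_const.add ((contDiffOn_inChart hX.normal_smooth p).inner ℝ contDiffOn_const)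

/-- Vanishing of the curvatures and of the Laplacians in the chart around a point. -/
theorem IsMinimalSurface.flat_and_harmonic_inChart (hX : IsMinimalSurface X N) (hV : ‖V‖ = 1)
    (hK : ∀ p, surfaceCurvature X p < 0) (hN : ∀ p, -1 < angle N V p) (p : S) :
    gaussCurvature (ricciMetric X) p = 0 ∧
    gaussCurvature (chernMetric X N V) p = 0 ∧
    laplacian (inducedMetric X) (chernRicciFunction X N V) p = 0 ∧
    laplacian (ricciMetric X) (chernRicciFunction X N V) p = 0 ∧
    laplacian (chernMetric X N V) (chernRicciFunction X N V) p = 0 := by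
  have hXd : MDifferentiable (𝓡 2) (𝓡 3) X := hX.smooth.mdifferentiable (by simp)
  have hU := isOpen_chart_target p
  have hx : extChartAt (𝓡 2) p p ∈ (extChartAt (𝓡 2) p).target := mem_extChartAt_target p
  set U := (extChartAt (𝓡 2) p).target
  set x := extChartAt (𝓡 2) p p
  set k := inChart (fun q => -surfaceCurvature X q) p
  set t := inChart (fun q => 1 + angle N V q) p
  set n := inChart N p with hndef
  have hV' : ⟪V, V⟫ = 1 := by rw [real_inner_self_eq_norm_sq, hV]; norm_num
  have hk0 : ∀ y ∈ U, 0 < k y := fun y _ => neg_pos.2 (hK _)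
  have ht0 : ∀ y ∈ U, 0 < t y := fun y _ => by
    have := hN ((extChartAt (𝓡 2) p).symm y)
    change 0 < 1 + angle N V ((extChartAt (𝓡 2) p).symm y)
    linarith
  have hY := contDiffOn_inChart hX.smooth p
  have hn : ContDiffOn ℝ ∞ n U := contDiffOn_inChart hX.normal_smooth p
  have hY1 : ∀ i, ContDiffOn ℝ ∞ (vderiv i (inChart X p)) U := contDiffOn_vderiv hU hY
  have hn1 : ∀ y ∈ U, ⟪n y, n y⟫ = 1 := fun y _ => by
    rw [real_inner_self_eq_norm_sq, hndef, inChart, Function.comp, hX.normal_unit]; norm_num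
  have hM := chartMatrix_inducedMetric (p := p) hXd
  have h3 : ∀ y ∈ U, ∀ i j, _ := fun y hy i j => hX.inner_vderiv_inChart hy i j
  -- The projected Gauss map induces `(k / t²) g`.
  have hs : ∀ y ∈ U, ∀ i j, ⟪vderiv i (stereo V n) y, vderiv j (stereo V n) y⟫
      = k y / t y ^ 2 * ⟪vderiv i (inChart X p) y, vderiv j (inChart X p) y⟫ := fun y hy i j => by
    rw [inner_vderiv_stereo hU hn hV' hn1 ht0 hy, h3 y hy, div_mul_eq_mul_div]
    rfl
  -- Gram determinants scale by the square of the conformal factor, so negative curvature makes the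
  -- Gauss map, and below its projection, an immersion.
  have hDn : ∀ y ∈ U, 0 < gramDet n y := fun y hy => by
    have : gramDet n y = k y ^ 2 * gramDet (inChart X p) y := by
      simp only [gramDet, hndef, h3 y hy]; ring
    rw [this]
    exact mul_pos (pow_pos (hk0 y hy) 2) (hX.gramDet_pos hy)
  have hDs : ∀ y ∈ U, 0 < gramDet (stereo V n) y := fun y hy => by
    have : gramDet (stereo V n) y = (k y / t y ^ 2) ^ 2 * gramDet (inChart X p) y := by
      simp only [gramDet, hs y hy]; ring
    rw [this]
    exact mul_pos (pow_pos (div_pos (hk0 y hy) (pow_pos (ht0 y hy) 2)) 2) (hX.gramDet_pos hy)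
  have hmat : ∀ (Z : E2 → E3) (r : E2 → ℝ), (∀ y ∈ U, ∀ i j, ⟪vderiv i Z y, vderiv j Z y⟫
      = r y * ⟪vderiv i (inChart X p) y, vderiv j (inChart X p) y⟫) →
      Set.EqOn (fun y => r y • paramMetric (inChart X p) y) (paramMetric Z) U := by
    intro Z r h y hy
    simp only [paramMetric, metricMatrix, h y hy, Matrix.smul_of, Matrix.smul_cons, smul_eq_mul,
      Matrix.smul_empty]
  obtain ⟨r1, r2, r3, r4, r5⟩ := coord_flat_and_harmonic hU ((hY1 0).inner ℝ (hY1 0))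
    ((hY1 0).inner ℝ (hY1 1)) ((hY1 1).inner ℝ (hY1 1)) (hX.contDiffOn_curvature p)
    (hX.contDiffOn_angle V p) (fun y hy => hX.gramDet_pos hy) hk0 ht0 hx
    (by
      refine (coordGaussCurvature_congr hU hM hx).symm.trans ?_
      change _ = - -surfaceCurvature X ((extChartAt (𝓡 2) p).symm (extChartAt (𝓡 2) p p))
      rw [extChartAt_to_inv, neg_neg]
      rfl)
    ((coordGaussCurvature_congr hU (hmat n k h3) hx).trans
      (coordGaussCurvature_sphere hU hn hDn hn1 hx))
    ((coordGaussCurvature_congr hU (hmat _ (fun y => k y / t y ^ 2) hs) hx).trans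
      (coordGaussCurvature_plane hU (contDiffOn_stereo hn ht0) hDs hV'
        (fun y hy => inner_stereo hV' (ht0 y hy)) hx))
  have hM' : ∀ lam : S → ℝ, Set.EqOn (chartMatrix (conformalChange lam (inducedMetric X)) p)
      (fun y => inChart lam p y • paramMetric (inChart X p) y) U := fun lam y hy => by
    rw [chartMatrix_conformalChange]
    exact congrArg _ (hM hy)
  have hf : Set.EqOn (chernRicciFunction X N V ∘ (extChartAt (𝓡 2) p).symm)
      (fun y => Real.log (t y ^ 2 / √(k y))) U := fun _ _ => rfl
  exact ⟨(coordGaussCurvature_congr hU (hM' _) hx).trans r1,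
    (coordGaussCurvature_congr hU (hM' _) hx).trans r2,
    (coordLaplacian_congr hU hM hf hx).trans r3,
    (coordLaplacian_congr hU (hM' _) hf hx).trans r4,
    (coordLaplacian_congr hU (hM' _) hf hx).trans r5⟩

end Minimal

end ChernRicci

theorem mainTheorem1 {S : Type*} [TopologicalSpace S] [ChartedSpace E2 S]
    [IsManifold (𝓡 2) ∞ S] (X N : S → E3) (hX : IsMinimalSurface X N)
    (V : E3) (hV : ‖V‖ = 1)
    (hK : ∀ p, surfaceCurvature X p < 0) (hN : ∀ p, -1 < angle N V p) :
    IsFlatMetric (ricciMetric X) ∧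
    IsFlatMetric (chernMetric X N V) ∧
    chernMetric X N V = conformalChange (starFactor X N V) (ricciMetric X) ∧
    IsHarmonic (inducedMetric X) (chernRicciFunction X N V) ∧
    IsHarmonic (ricciMetric X) (chernRicciFunction X N V) ∧
    IsHarmonic (chernMetric X N V) (chernRicciFunction X N V) := by
  have hk0 : ∀ q, 0 < -surfaceCurvature X q := fun q => neg_pos.2 (hK q)
  have hs0 : ∀ q, 0 < √(-surfaceCurvature X q) := fun q => Real.sqrt_pos.2 (hk0 q)
  have ht0 : ∀ q, 0 < (1 + angle N V q) ^ 2 := fun q => by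
    have := hN q
    exact pow_pos (by linarith) 2
  have hsk : ∀ p, ContDiffOn ℝ ∞ (inChart (fun q => √(-surfaceCurvature X q)) p)
      (extChartAt (𝓡 2) p).target := fun p =>
    (hX.contDiffOn_curvature p).sqrt fun _ _ => (hk0 _).ne'
  have htt : ∀ p, ContDiffOn ℝ ∞ (inChart (fun q => (1 + angle N V q) ^ 2) p)
      (extChartAt (𝓡 2) p).target := fun p => (hX.contDiffOn_angle V p).pow 2
  have hsmooth : ContMDiff (𝓡 2) 𝓘(ℝ, ℝ) 2 (chernRicciFunction X N V) :=
    contMDiff_of_inChart fun p => ((htt p).div (hsk p) fun _ _ => (hs0 _).ne').log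
      fun _ _ => (div_pos (ht0 _) (hs0 _)).ne'
  have h := hX.flat_and_harmonic_inChart hV hK hN
  refine ⟨⟨isRiemannianMetric_conformalChange hX.smooth hX.immersion hs0 hsk, fun p => (h p).1⟩,
    ⟨isRiemannianMetric_conformalChange hX.smooth hX.immersion ht0 htt, fun p => (h p).2.1⟩, ?_,
    ⟨hsmooth, fun p => (h p).2.2.1⟩, ⟨hsmooth, fun p => (h p).2.2.2.1⟩,
    ⟨hsmooth, fun p => (h p).2.2.2.2⟩⟩
  funext p
  simp only [chernMetric, ricciMetric, conformalChange, starFactor]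
  rw [smul_smul, div_mul_cancel₀ _ (hs0 p).ne']
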